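/- Let $N,M,D$ be finite non-empty sets, whose sizes are denoted by the same letters. Let $\mathrm{Con}=\{f_s\}_{s\in D}$ be a family of functions $f_s:N\to M$, with linear map $[\mathrm{Con}](P)=\frac1D\sum_{s\in D}F_s(P)$, where $F_s$ is the 0/1 matrix of $f_s$, and let $G$ be the bipartite graph with left vertices $N$, right vertices $M$, left degree $D$ and neighbour function $\Gamma(x,s)=f_s(x)$. Let $k,k'$ be real numbers such that $\gamma=N2^{-k}$ and $\gamma'=M2^{-k'}$ are integers. The game $(G;2^k,2^{k'})$: the referee draws $s\in D$, $\vec x\in N^{\gamma}$, $\vec y\in M^{\gamma'}$ uniformly and independently; Alice receives $\vec x$ and answers $\alpha\in\{1,\dots,\gamma\}$, Bob receives $\vec y$ and answers $\beta\in\{1,\dots,\gamma'\}$; they win if $\Gamma(x_\alpha,s)=y_\beta$. Let $\omega(G;2^k,2^{k'})$ be the maximal winning probability with deterministic strategies, $\omega^*_Q(G;2^k,2^{k'})$ the supremum of the winning probabilities when the players share a pure state in $\mathbb C^Q\otimes\mathbb C^Q$ and answer by (possibly incomplete) POVMs in $\mathrm{Mat}_Q$ indexed by their questions, and $\omega^*=\sup_Q\omega^*_Q$.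 Norms: on $\mathbb C^N$, $\|x\|_{\cap\{2^k\ell_\infty,\ell_1\}}=\max\{2^k\|x\|_\infty,\|x\|_1\}$; on $\mathbb C^M$, $\|y\|_{\Sigma\{2^{k'}\ell_\infty,\ell_1\}}=\inf\{2^{k'}\|y_1\|_\infty+\|y_2\|_1:y_1+y_2=y\}$. For $x\in\mathrm{Mat}_Q(\mathbb C^N)$, seen as a block-diagonal element of $\mathrm{Mat}_{QN}$, the operator space $\cap\cdot\cap\{2^k\ell_\infty,\ell_1\}$ has the norms $$\|x\|=\inf\Big\{\max\{2^{k/2}\|a\|,\|\Lambda(a)\|\}\cdot\max\{2^{k/2}\|b\|,\|\Lambda(b)\|\}:\ x=ab^*,\ a,b\in\mathrm{Mat}_{QN}\Big\},$$ where $\|\cdot\|$ on the right is the operator norm and $\Lambda(|i\rangle\langle j|\otimes|u\rangle\langle v|)=|i\rangle\langle j|\otimes\langle u|\otimes\langle v|$. The operator space $\Sigma\cdot\Sigma\{2^{k'}\ell_\infty,\ell_1\}$ is $2^{k'}$ times the operator space dual of $\cap\cdot\cap\{2^{k'}\ell_\infty,\ell_1\}$ on $\mathbb C^M$. Write $\|[\mathrm{Con}]\|_Q$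 for the norm of $1_Q\otimes[\mathrm{Con}]$ from $M_Q(\cap\cdot\cap\{2^k\ell_\infty,\ell_1\})$ to $M_Q(\Sigma\cdot\Sigma\{2^{k'}\ell_\infty,\ell_1\})$ (the quantity for $Q$-dimensional quantum side information), and $\|[\mathrm{Con}]\|_{\mathrm{cb}}=\sup_Q\|[\mathrm{Con}]\|_Q$. Theorem. There is a universal constant $c>0$ such that, for all such data, $$\omega(G;2^k,2^{k'})\le 2^{-k'}\big\|[\mathrm{Con}]:\cap\{2^k\ell_\infty,\ell_1\}\to\Sigma\{2^{k'}\ell_\infty,\ell_1\}\big\|\le c\,\omega(G;2^k,2^{k'}),$$ $$\omega^*(G;2^k,2^{k'})\le 2^{-k'}\big\|[\mathrm{Con}]:\cap\cdot\cap\{2^k\ell_\infty,\ell_1\}\to\Sigma\cdot\Sigma\{2^{k'}\ell_\infty,\ell_1\}\big\|_{\mathrm{cb}}\le c\,\omega^*(G;2^k,2^{k'}).$$ Furthermore, the local dimension of the entanglement corresponds to the dimension of the quantum side information: for every $Q\ge1$, $$\omega^*_Q(G;2^k,2^{k'})\le 2^{-k'}\|[\mathrm{Con}]\|_Q\le c\,\omega^*_Q(G;2^k,2^{k'}).$$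 -/

import Mathlib

open scoped ENNReal NNReal BigOperators Matrix Kronecker ComplexOrder

namespace Condenser

section OperatorNorm

open scoped Matrix.Norms.L2Operator

/-- The operator norm (largest singular value) of a complex matrix. -/
noncomputable def opNorm {m n : Type} [Fintype m] [Fintype n] [DecidableEq n]
    (A : Matrix m n ℂ) : ℝ := ‖A‖

end OperatorNorm

/-! ### The linear map of a condenser -/

/-- The `M × N` matrix of a function `g : N → M`: entry `(y, x)` is `1` if `g x = y`, else `0`. -/
def functionMatrix {N M : ℕ} (g : Fin N → Fin M) : Matrix (Fin M) (Fin N) ℂ :=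
  Matrix.of fun y x => if g x = y then 1 else 0

/-- The linear map `[Con](P) = (1/D) ∑ₛ Fₛ(P)` of a family `Con = (fₛ)ₛ`. -/
noncomputable def conMap {N M D : ℕ} (f : Fin D → Fin N → Fin M) :
    (Fin N → ℂ) →ₗ[ℂ] (Fin M → ℂ) :=
  Matrix.mulVecLin ((D : ℂ)⁻¹ • ∑ s, functionMatrix (f s))

/-- The neighbour function `Γ(x, s) = fₛ(x)` of the bipartite graph of a condenser, with left
vertices `N`, right vertices `M` and left degree `D`. -/
def neighbor {N M D : ℕ} (f : Fin D → Fin N → Fin M) : Fin N → Fin D → Fin M :=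
  fun x s => f s x

/-! ### Norms on `ℂ^N` (the norm `‖x‖` of a function on `Fin N` is the sup norm) -/

/-- `‖x‖_{∩{K ℓ∞, ℓ1}} = max {K ‖x‖_∞, ‖x‖_1}`. -/
noncomputable def capNorm {N : ℕ} (K : ℝ) (x : Fin N → ℂ) : ℝ :=
  max (K * ‖x‖) (∑ i, ‖x i‖)

/-- `‖y‖_{Σ{K ℓ∞, ℓ1}} = inf {K ‖y₁‖_∞ + ‖y₂‖_1 : y₁ + y₂ = y}`. -/
noncomputable def sigmaNorm {M : ℕ} (K : ℝ) (y : Fin M → ℂ) : ℝ≥0∞ :=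
  ⨅ (y₁ : Fin M → ℂ) (y₂ : Fin M → ℂ) (_ : y₁ + y₂ = y),
    ENNReal.ofReal (K * ‖y₁‖ + ∑ i, ‖y₂ i‖)

/-- The bounded norm `‖u : ∩{K ℓ∞, ℓ1} → Σ{K' ℓ∞, ℓ1}‖`. -/
noncomputable def boundedNorm {N M : ℕ} (K K' : ℝ)
    (u : (Fin N → ℂ) →ₗ[ℂ] (Fin M → ℂ)) : ℝ≥0∞ :=
  ⨆ (x : Fin N → ℂ) (_ : capNorm K x ≤ 1), sigmaNorm K' (u x)

/-! ### Matrix norms on `Mat_Q(ℂ^N)` and completely bounded norms -/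

/-- `Mat_Q(ℂ^N)`: the element `x = ∑ⱼ x(j) ⊗ |j⟩⟨j|` is given by its blocks `x(j) ∈ Mat_Q`. -/
abbrev MatOver (Q N : ℕ) : Type := Fin N → Matrix (Fin Q) (Fin Q) ℂ

/-- A sequence of (extended) norms on the spaces `Mat_Q(ℂ^N)`, `Q ∈ ℕ`. -/
abbrev MatNorms (N : ℕ) : Type := (Q : ℕ) → MatOver Q N → ℝ≥0∞

/-- The amplification `u_Q = 1_Q ⊗ u`, that is, `u` applied to every matrix entry. -/
def amplification {N M : ℕ} (u : (Fin N → ℂ) →ₗ[ℂ] (Fin M → ℂ)) {Q : ℕ}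
    (x : MatOver Q N) : MatOver Q M :=
  fun y => Matrix.of fun i j => u (fun l => x l i j) y

/-- The norm of `u_Q : M_Q(E) → M_Q(F)`. -/
noncomputable def amplifiedNorm {N M : ℕ} (E : MatNorms N) (F : MatNorms M) (Q : ℕ)
    (u : (Fin N → ℂ) →ₗ[ℂ] (Fin M → ℂ)) : ℝ≥0∞ :=
  ⨆ (x : MatOver Q N) (_ : E Q x ≤ 1), F Q (amplification u x)

/-- The completely bounded norm `‖u : E → F‖_cb = sup_Q ‖u_Q : M_Q(E) → M_Q(F)‖`. -/
noncomputable def cbNorm {N M : ℕ} (E : MatNorms N) (F : MatNorms M)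
    (u : (Fin N → ℂ) →ₗ[ℂ] (Fin M → ℂ)) : ℝ≥0∞ :=
  ⨆ Q : ℕ, amplifiedNorm E F Q u

/-- The operator space dual: `‖x‖_{M_Q(E*)} = ‖x : E → M_Q‖_cb`, where `x ∈ Mat_Q(ℂ^N)` is the
map `v ↦ ∑ⱼ v(j) x(j)`; its amplification of order `R` sends `z` to `∑ⱼ z(j) ⊗ x(j)`. -/
noncomputable def opDual {N : ℕ} (E : MatNorms N) : MatNorms N := fun Q x =>
  ⨆ (R : ℕ) (z : MatOver R N) (_ : E R z ≤ 1), ENNReal.ofReal (opNorm (∑ j, z j ⊗ₖ x j))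

/-- The reshuffling `|i⟩⟨j| ⊗ |k⟩⟨l| ↦ |i⟩⟨j| ⊗ ⟨k| ⊗ ⟨l|`. -/
def reshuffle {Q N : ℕ} (a : Matrix (Fin Q × Fin N) (Fin Q × Fin N) ℂ) :
    Matrix (Fin Q) (Fin Q × Fin N × Fin N) ℂ :=
  Matrix.of fun i t => a (i, t.2.1) (t.1, t.2.2)

/-- `max {√K ‖a‖_∞, ‖reshuffle a‖_∞}`. -/
noncomputable def factorNorm {Q N : ℕ} (K : ℝ)
    (a : Matrix (Fin Q × Fin N) (Fin Q × Fin N) ℂ) : ℝ :=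
  max (√K * opNorm a) (opNorm (reshuffle a))

/-- The operator space `∩·∩{K ℓ∞, ℓ1}`: the infimum over the factorizations `x = a b*` in
`Mat_{QN}` of the product of the two factor norms, `x` being seen as a block-diagonal matrix. -/
noncomputable def capCap (N : ℕ) (K : ℝ) : MatNorms N := fun _ x =>
  ⨅ (a) (b) (_ : a * bᴴ = Matrix.blockDiagonal x),
    ENNReal.ofReal (factorNorm K a * factorNorm K b)

/-- The operator space `Σ·Σ{K ℓ∞, ℓ1} = K · Σ·Σ{ℓ∞, K⁻¹ ℓ1}`, where `Σ·Σ{ℓ∞, K⁻¹ ℓ1}` is the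
operator space dual of `∩·∩{K ℓ∞, ℓ1}`. -/
noncomputable def sigmaSigma (N : ℕ) (K : ℝ) : MatNorms N := fun Q x =>
  ENNReal.ofReal K * opDual (capCap N K) Q x

/-! ### The two-player game

The referee draws a seed `s ∈ D` and vectors `x ∈ N^γ`, `y ∈ M^γ'`, all uniform and independent.
Alice gets `x`, Bob gets `y`, they answer `α` and `β`, and win if `Γ(x_α, s) = y_β`. -/

/-- `1` if `Γ(x, s) = y`, and `0` otherwise. -/
def edgeIndicator {N M D : ℕ} (G : Fin N → Fin D → Fin M) (x : Fin N) (s : Fin D)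
    (y : Fin M) : ℝ :=
  if G x s = y then 1 else 0

/-- The classical value: the supremum over deterministic strategies `a`, `b`. -/
noncomputable def classicalValue {N M D : ℕ} (G : Fin N → Fin D → Fin M) (γ γ' : ℕ) : ℝ≥0∞ :=
  ⨆ (a : (Fin γ → Fin N) → Fin γ) (b : (Fin γ' → Fin M) → Fin γ'),
    ENNReal.ofReal (𝔼 s : Fin D, 𝔼 x : Fin γ → Fin N, 𝔼 y : Fin γ' → Fin M,
      edgeIndicator G (x (a x)) s (y (b y)))

/-- A family of (possibly incomplete) POVMs in `Mat_Q`, one for each question in `X`, with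
outcomes in `A`. -/
def IsPOVMFamily {X A : Type} [Fintype A] {Q : ℕ} (p : A → X → Matrix (Fin Q) (Fin Q) ℂ) :
    Prop :=
  (∀ a x, (p a x).PosSemidef) ∧ ∀ x, (1 - ∑ a, p a x).PosSemidef

/-- The entangled value with local dimension `Q`: the supremum over unit vectors
`ψ ∈ ℂ^Q ⊗ ℂ^Q` and pairs of POVM families. -/
noncomputable def entangledValueDim {N M D : ℕ} (G : Fin N → Fin D → Fin M) (γ γ' Q : ℕ) :
    ℝ≥0∞ :=
  ⨆ (ψ : Fin Q × Fin Q → ℂ) (_ : star ψ ⬝ᵥ ψ = 1)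
    (p : Fin γ → (Fin γ → Fin N) → Matrix (Fin Q) (Fin Q) ℂ) (_ : IsPOVMFamily p)
    (q : Fin γ' → (Fin γ' → Fin M) → Matrix (Fin Q) (Fin Q) ℂ) (_ : IsPOVMFamily q),
    ENNReal.ofReal (𝔼 s : Fin D, 𝔼 x : Fin γ → Fin N, 𝔼 y : Fin γ' → Fin M,
      ∑ α, ∑ β, edgeIndicator G (x α) s (y β) *
        (star ψ ⬝ᵥ ((p α x ⊗ₖ q β y) *ᵥ ψ)).re)

/-- The entangled value: the supremum over all local dimensions. -/
noncomputable def entangledValue {N M D : ℕ} (G : Fin N → Fin D → Fin M) (γ γ' : ℕ) : ℝ≥0∞ :=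
  ⨆ Q : ℕ, entangledValueDim G γ γ' Q

end Condenser

/-! Call a positive family `a` bounded if `K a(u) ≤ 1` for each `u` and `∑ a(u) ≤ 1`
(`IsBoundedFamily`). Value and norm are both, up to constants, the supremum of the form `∑ w(v,u)
β(c(v), a(u))` over pairs of bounded families, where `w(v,u)` is the probability that `f_s(u) = v`
and `β` is a positive bilinear form (`⟨φ, (X ⊗ Y) φ⟩` in the entangled case).

Value at most norm: averaging a strategy over the questions yields a bounded family
(`isBoundedFamily_avgFamily`), since a given `u` occupies on average `γ/N = 1/K` positions. Bounded
families lie in the unit balls (`capCap_le_one`, `capNorm_le_one`).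

Norm at most constant times value: a bounded family is rounded to a strategy by measuring the
effects `E(x₀), E(x₁), …`, with `E = (K/4) a`, one after the other. The effects do not commute, so
the disturbance caused by earlier measurements has to be controlled. An outcome has the form `Π E
Π*`, with `Π` independent of the current letter, and `Π E Π* ≥ Π E + E Π* - E`. The right side is
linear in `Π`, so `Π` may be replaced by its mean `m^α`, which is within `1/4` of `1`. The remaining
error is a conjugate `h a h` of the family, again bounded, hence controlled by the optimum. A nearly
optimal `a` therefore loses only a factor 16 (`le_expect_seqMeas`, `exists_meas_forall_le`).
Rounding the players in turn costs `16² = 256` (`exists_meas_pair`).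

In the entangled case, a general element of the unit ball is a product `a b*`, and Cauchy–Schwarz
reduces it to the positive families given by the row blocks of `a` and of `b`
(`opNorm_le_of_capCap`). The dual norm allows any dimension `R` on the other side, but a vector of
`ℂ^R ⊗ ℂ^Q` only needs `Q` dimensions of `ℂ^R` (`exists_compression`), so the dimension `Q` is
preserved. In the classical case the norm `Σ` is attained within a factor 3 on a flat family
supported on the largest coordinates (`exists_sigmaNorm_le`), giving `3 · 256 = 768`. -/

namespace Condenser

/-! ### Sequential measurements in a C⋆-algebra -/

section Rounding

variable {A : Type*} [CStarAlgebra A]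

/-- The product `(1 - E(x₀)) ⋯ (1 - E(x_{α-1}))`. -/
def seqProd {ι : Type*} (E : ι → A) : {n : ℕ} → Fin n → (Fin n → ι) → A
  | 0, α, _ => α.elim0
  | _ + 1, α, x => Fin.cases 1 (fun j => (1 - E (x 0)) * seqProd E j (Fin.tail x)) α

/-- The outcome `α` of the sequential measurement of `E(x₀), E(x₁), …`. -/
def seqMeas {ι : Type*} (E : ι → A) {n : ℕ} (α : Fin n) (x : Fin n → ι) : A :=
  seqProd E α x * E (x α) * star (seqProd E α x)

theorem expect_pi_succ {ι : Type*} [Fintype ι] {n : ℕ} (F : (Fin (n + 1) → ι) → ℝ) :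
    𝔼 x, F x = 𝔼 w, 𝔼 x : Fin n → ι, F (Fin.cons w x) := by
  rw [← Finset.expect_product' (s := Finset.univ) (t := Finset.univ)
    (f := fun w (x : Fin n → ι) => F (Fin.cons w x)), Finset.univ_product_univ]
  exact (Fintype.expect_equiv (Fin.consEquiv fun _ => ι) _ _ fun _ => rfl).symm

theorem expect_eval {ι : Type*} [Fintype ι] [Nonempty ι] (F : ι → ℝ) :
    ∀ {n : ℕ} (α : Fin n), 𝔼 x : Fin n → ι, F (x α) = 𝔼 u, F u
  | 0, α => α.elim0
  | n + 1, α => by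
    rw [expect_pi_succ]
    induction α using Fin.cases with
    | zero => simp
    | succ j => simp [expect_eval F j]

/-- The product involves only letters before position `α`, so it is independent of `x α`, and its
factors are independent of each other with mean `m`. The functional `L` is arbitrary so that the
induction can absorb the first factor into it. -/
theorem expect_seqProd {ι : Type*} [Fintype ι] [Nonempty ι] (E : ι → A) {m : A}
    (hm : m = (Fintype.card ι : ℝ)⁻¹ • ∑ w, (1 - E w)) :
    ∀ {n : ℕ} (α : Fin n) (L : ι → A →ₗ[ℝ] ℝ),
      𝔼 x : Fin n → ι, L (x α) (seqProd E α x) = 𝔼 u, L u (m ^ (α : ℕ))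
  | 0, α, _ => α.elim0
  | n + 1, α, L => by
    rw [expect_pi_succ]
    induction α using Fin.cases with
    | zero => simp [seqProd]
    | succ j =>
      have ih : ∀ w, 𝔼 x : Fin n → ι, L (x j) ((1 - E w) * seqProd E j x)
          = 𝔼 u, L u ((1 - E w) * m ^ (j : ℕ)) := fun w =>
        expect_seqProd E hm j fun u => L u ∘ₗ LinearMap.mulLeft ℝ (1 - E w)
      simp only [seqProd, Fin.cases_succ, Fin.cons_zero, Fin.cons_succ, Fin.tail_cons, ih]
      rw [Finset.expect_comm]
      refine Finset.expect_congr rfl fun u _ => ?_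
      have hmul : m * m ^ (j : ℕ)
          = (Fintype.card ι : ℝ)⁻¹ • ((∑ w, (1 - E w)) * m ^ (j : ℕ)) := by
        rw [← smul_mul_assoc, ← hm]
      rw [Fin.val_succ, pow_succ', Fintype.expect_eq_sum_div_card, ← map_sum, ← Finset.sum_mul,
        hmul, map_smul, smul_eq_mul, div_eq_inv_mul]

theorem norm_one_sub_pow_le {m : A} (hm : ‖m‖ ≤ 1) (j : ℕ) : ‖1 - m ^ j‖ ≤ j * ‖1 - m‖ := by
  induction j with
  | zero => simp
  | succ j ih =>
    have : 1 - m ^ (j + 1) = (1 - m ^ j) * m + (1 - m) := by rw [pow_succ]; noncomm_ring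
    rw [this]
    calc _ ≤ ‖1 - m ^ j‖ * ‖m‖ + ‖1 - m‖ := (norm_add_le _ _).trans (by gcongr; exact norm_mul_le _ _)
      _ ≤ ‖1 - m ^ j‖ * 1 + ‖1 - m‖ := by gcongr
      _ ≤ j * ‖1 - m‖ * 1 + ‖1 - m‖ := by gcongr
      _ = _ := by push_cast; ring

/-- The family of average outcomes of a strategy. -/
noncomputable def avgFamily {N γ : ℕ} (P : Fin γ → (Fin γ → Fin N) → A) (u : Fin N) : A :=
  (Fintype.card (Fin γ → Fin N) : ℝ)⁻¹ • ∑ x, ∑ α, if x α = u then P α x else 0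

/-- A strategy enters linear averages over the questions only through its averaged family. -/
theorem sum_apply_avgFamily {N γ : ℕ} (P : Fin γ → (Fin γ → Fin N) → A)
    (L : Fin N → A →ₗ[ℝ] ℝ) :
    ∑ u, L u (avgFamily P u) = 𝔼 x : Fin γ → Fin N, ∑ α, L (x α) (P α x) := by
  simp only [avgFamily, map_smul, map_sum, smul_eq_mul, apply_ite (L _), map_zero]
  rw [← Finset.mul_sum, Finset.sum_comm, Fintype.expect_eq_sum_div_card, div_eq_inv_mul]
  congr 1
  refine Finset.sum_congr rfl fun x _ => ?_
  rw [Finset.sum_comm]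
  simp

/-! ### Bounded families and the rounding of one family. -/

variable [PartialOrder A] [StarOrderedRing A]

/-- Positive families `a` with `K a(u) ≤ 1` for all `u`, and `∑ᵤ a(u) ≤ 1`. -/
structure IsBoundedFamily {ι : Type*} [Fintype ι] (K : ℝ) (a : ι → A) : Prop where
  nonneg : ∀ u, 0 ≤ a u
  smul_le_one : ∀ u, K • a u ≤ 1
  sum_le_one : ∑ u, a u ≤ 1

/-- Makes the error term of the rounding a competitor in the same optimization problem. -/
theorem IsBoundedFamily.conj {ι : Type*} [Fintype ι] {K : ℝ} {a : ι → A}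
    (ha : IsBoundedFamily K a) {h : A} (hn : ‖h‖ ≤ 1) :
    IsBoundedFamily K fun u => star h * a u * h := by
  have key : star h * 1 * h ≤ 1 := by
    rw [mul_one]
    calc star h * h ≤ algebraMap ℝ A (‖h‖ ^ 2) := CStarAlgebra.star_mul_le_algebraMap_norm_sq
      _ ≤ algebraMap ℝ A 1 := algebraMap_mono _ (pow_le_one₀ (norm_nonneg _) hn)
      _ = 1 := map_one _
  refine ⟨fun u => star_left_conjugate_nonneg (ha.nonneg u) h, fun u => ?_, ?_⟩
  · have := star_left_conjugate_le_conjugate (ha.smul_le_one u) h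
    rw [mul_smul_comm, smul_mul_assoc] at this
    exact this.trans key
  · have := star_left_conjugate_le_conjugate ha.sum_le_one h
    rw [Finset.mul_sum, Finset.sum_mul] at this
    exact this.trans key

theorem seqMeas_nonneg {ι : Type*} {E : ι → A} (hE : ∀ u, 0 ≤ E u) {n : ℕ} (α : Fin n)
    (x : Fin n → ι) : 0 ≤ seqMeas E α x :=
  star_right_conjugate_nonneg (hE _) _

/-- With `e` the first effect, the sum is `e + (1 - e) X (1 - e)`, where `X ≤ 1` by induction, and
`e + (1 - e)² = 1 - e (1 - e) ≤ 1`. -/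
theorem sum_seqMeas_le_one {ι : Type*} {E : ι → A} (hE : ∀ u, 0 ≤ E u) (hE' : ∀ u, E u ≤ 1) :
    ∀ {n : ℕ} (x : Fin n → ι), ∑ α, seqMeas E α x ≤ 1
  | 0, x => by simp
  | n + 1, x => by
    have ih := sum_seqMeas_le_one hE hE' (Fin.tail x)
    set e := E (x 0) with he
    have hsa : star (1 - e) = 1 - e := by rw [star_sub, star_one, (hE _).star_eq]
    have h0 : seqMeas E 0 x = e := by simp [seqMeas, seqProd, he]
    have hs : ∀ j : Fin n, seqMeas E j.succ x
        = (1 - e) * seqMeas E j (Fin.tail x) * star (1 - e) := fun j => by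
      simp only [seqMeas, seqProd, Fin.cases_succ, star_mul, Fin.tail, he, mul_assoc]
    rw [Fin.sum_univ_succ, h0]
    simp_rw [hs]
    rw [← Finset.sum_mul, ← Finset.mul_sum]
    have h1 := star_right_conjugate_le_conjugate ih (1 - e)
    rw [hsa] at h1
    have h2 : 0 ≤ e * (1 - e) := by
      have h3 : 0 ≤ e * (1 - e) * star e + (1 - e) * e * star (1 - e) :=
        add_nonneg (star_right_conjugate_nonneg (sub_nonneg.2 (hE' _)) _)
          (star_right_conjugate_nonneg (hE _) _)
      rw [hsa, (hE _).star_eq] at h3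
      convert h3 using 1
      noncomm_ring
    rw [hsa]
    calc _ ≤ e + (1 - e) * 1 * (1 - e) := by gcongr
      _ ≤ e + (1 - e) * 1 * (1 - e) + e * (1 - e) := le_add_of_nonneg_right h2
      _ = 1 := by noncomm_ring

/-- The average outcome of a sequential measurement is at least a constant times the average of
the effects, up to an error controlled by the supremum `B` of the functional. -/
theorem le_expect_seqMeas {N γ : ℕ} (hN : 0 < N) {K : ℝ} (hK : 0 < K)
    (hγ : (γ : ℝ) = N / K) {φ : Fin N → A →ₗ[ℝ] ℝ} (hφ : ∀ u a, 0 ≤ a → 0 ≤ φ u a) {B : ℝ}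
    (hB : ∀ a, IsBoundedFamily K a → ∑ u, φ u (a u) ≤ B) {a : Fin N → A}
    (ha : IsBoundedFamily K a) :
    ∑ u, φ u (a u) ≤ B / 2 + 4 * 𝔼 x : Fin γ → Fin N,
      ∑ α, φ (x α) (seqMeas (fun u => (K / 4) • a u) α x) := by
  have : Nonempty (Fin N) := ⟨⟨0, hN⟩⟩
  have hN' : (0 : ℝ) < N := by exact_mod_cast hN
  have hγ0 : (0 : ℝ) < γ := by rw [hγ]; positivity
  -- The factor `1/4` gives `‖1 - m‖ ≤ 1/(4γ)`, so that `γ` successive factors stay within `1/4` of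
  -- the identity.
  set E : Fin N → A := fun u => (K / 4) • a u with hE
  have hE0 : ∀ u, 0 ≤ E u := fun u => smul_nonneg (by positivity) (ha.nonneg u)
  set m : A := (Fintype.card (Fin N) : ℝ)⁻¹ • ∑ w, (1 - E w) with hm
  have hm1 : 1 - m = (1 / (4 * γ) : ℝ) • ∑ u, a u := by
    rw [hm, Finset.sum_sub_distrib, smul_sub, hE, ← Finset.smul_sum, smul_smul]
    simp only [Finset.sum_const, Finset.card_univ, Fintype.card_fin]
    rw [← Nat.cast_smul_eq_nsmul ℝ, smul_smul, inv_mul_cancel₀ hN'.ne', one_smul, sub_sub_cancel]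
    congr 1
    rw [hγ]; field_simp
  have hS0 : 0 ≤ ∑ u, a u := Finset.sum_nonneg fun u _ => ha.nonneg u
  have hSn : ‖∑ u, a u‖ ≤ 1 := (CStarAlgebra.norm_le_one_iff_of_nonneg _ hS0).2 ha.sum_le_one
  have hγ1 : (1 : ℝ) ≤ γ := by
    have : 0 < γ := by exact_mod_cast hγ0
    exact_mod_cast this
  have h1m0 : 0 ≤ 1 - m := by rw [hm1]; exact smul_nonneg (by positivity) hS0
  have h1mn : ‖1 - m‖ ≤ 1 / (4 * γ) := by
    rw [hm1, norm_smul, Real.norm_of_nonneg (by positivity)]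
    exact mul_le_of_le_one_right (by positivity) hSn
  have h1m1 : 1 - m ≤ 1 := by
    rw [← CStarAlgebra.norm_le_one_iff_of_nonneg _ h1m0]
    refine h1mn.trans ?_
    rw [div_le_one (by positivity)]; linarith
  have hm0 : 0 ≤ m := by simpa using h1m1
  have hmn : ‖m‖ ≤ 1 := by
    rw [CStarAlgebra.norm_le_one_iff_of_nonneg _ hm0]; simpa using h1m0
  have hmsa : star m = m := hm0.star_eq
  -- One position contributes this much; the `γ = N/K` positions together contribute a quarter of
  -- the bracket.
  have key : ∀ α : Fin γ, (K / (4 * N)) * (∑ u, φ u (a u) - B / 2) ≤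
      𝔼 x : Fin γ → Fin N, φ (x α) (seqMeas E α x) := by
    intro α
    set h : A := (4 : ℝ) • (1 - m ^ (α : ℕ)) with hh
    have hhsa : star h = h := by
      rw [hh, star_smul, star_sub, star_one, star_pow, hmsa, star_trivial]
    have hhn : ‖h‖ ≤ 1 := by
      rw [hh, norm_smul, Real.norm_of_nonneg (by norm_num)]
      have h1 := norm_one_sub_pow_le hmn (α : ℕ)
      have h2 : ((α : ℕ) : ℝ) ≤ γ := by exact_mod_cast α.2.le
      have h3 : ((α : ℕ) : ℝ) * ‖1 - m‖ ≤ γ * (1 / (4 * γ)) :=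
        mul_le_mul h2 h1mn (norm_nonneg _) (by positivity)
      have h4 : (γ : ℝ) * (1 / (4 * γ)) = 1 / 4 := by field_simp
      linarith
    have hconj := hB _ (ha.conj hhn)
    have ha' := hB _ ha
    let L : Fin N → A →ₗ[ℝ] ℝ := fun u => φ u ∘ₗ
      { toFun := fun g => g * E u + E u * star g
        map_add' := fun g g' => by rw [star_add]; noncomm_ring
        map_smul' := fun r g => by
          simp [star_smul, smul_add] }
    have hL : ∀ u g, L u g = φ u (g * E u + E u * star g) := fun _ _ => rfl
    have hexp := expect_seqProd E hm α L
    -- Positivity of `(1 - Π) E (1 - Π)*` bounds the quadratic expression in `Π` below by an affine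
    -- one, which can be averaged.
    have hlow : ∀ x : Fin γ → Fin N, L (x α) (seqProd E α x) - φ (x α) (E (x α)) ≤
        φ (x α) (seqMeas E α x) := fun x => by
      rw [hL, ← map_sub, ← sub_nonneg, ← map_sub]
      apply hφ
      have := star_right_conjugate_nonneg (hE0 (x α)) (1 - seqProd E α x)
      rw [star_sub, star_one] at this
      rw [seqMeas]
      convert this using 1
      noncomm_ring
    have hcomm : 𝔼 x : Fin γ → Fin N, φ (x α) (E (x α)) = 𝔼 u, φ u (E u) :=
      expect_eval (fun u => φ u (E u)) α
    -- With `m^α = 1 - h/4`, the cross terms `h a + a h` have no sign; positivity of `(1 - h) a (1 -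
    -- h)` bounds them by `a + h a h`.
    have hpt : ∀ u, (K / 4) * (φ u (a u) - φ u (a u) / 4 - φ u (star h * a u * h) / 4) ≤
        L u (m ^ (α : ℕ)) - φ u (E u) := fun u => by
      have hpos : 0 ≤ φ u ((1 - h) * a u * star (1 - h)) :=
        hφ _ _ (star_right_conjugate_nonneg (ha.nonneg u) _)
      have hmh : m ^ (α : ℕ) = 1 - (1 / 4 : ℝ) • h := by
        rw [hh, smul_smul]; norm_num
      have e1 : (1 - h) * a u * star (1 - h)
          = a u - (h * a u + a u * h) + star h * a u * h := by
        rw [star_sub, star_one, hhsa]; noncomm_ring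
      have e2 : L u (m ^ (α : ℕ)) - φ u (E u)
          = (K / 4) * (φ u (a u) - φ u (h * a u + a u * h) / 4) := by
        rw [hL, ← map_sub, star_pow, hmsa, hmh]
        have : (1 - (1 / 4 : ℝ) • h) * E u + E u * (1 - (1 / 4 : ℝ) • h) - E u
            = (K / 4) • (a u - (1 / 4 : ℝ) • (h * a u + a u * h)) := by
          simp only [hE, sub_mul, mul_sub, one_mul, mul_one, smul_mul_assoc, mul_smul_comm]
          module
        rw [this, map_smul, map_sub, map_smul, smul_eq_mul, smul_eq_mul]
        ring
      rw [e1, map_add, map_sub] at hpos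
      rw [e2]
      have : 0 < K / 4 := by positivity
      apply mul_le_mul_of_nonneg_left _ this.le
      linarith
    calc (K / (4 * N)) * (∑ u, φ u (a u) - B / 2)
        ≤ (K / (4 * N)) * (∑ u, φ u (a u) - (∑ u, φ u (a u)) / 4
            - (∑ u, φ u (star h * a u * h)) / 4) := by
          apply mul_le_mul_of_nonneg_left _ (by positivity)
          linarith
      _ = 𝔼 u, (K / 4) * (φ u (a u) - φ u (a u) / 4 - φ u (star h * a u * h) / 4) := by
          rw [Fintype.expect_eq_sum_div_card, ← Finset.mul_sum, Finset.sum_sub_distrib,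
            Finset.sum_sub_distrib, Finset.sum_div, Finset.sum_div, Fintype.card_fin]
          field_simp
      _ ≤ 𝔼 u, (L u (m ^ (α : ℕ)) - φ u (E u)) := Finset.expect_le_expect fun u _ => hpt u
      _ = 𝔼 x : Fin γ → Fin N, (L (x α) (seqProd E α x) - φ (x α) (E (x α))) := by
          rw [Finset.expect_sub_distrib, Finset.expect_sub_distrib, hexp, hcomm]
      _ ≤ _ := Finset.expect_le_expect fun x _ => hlow x
  have hsum := Finset.sum_le_sum fun (α : Fin γ) (_ : α ∈ Finset.univ) => key α
  rw [Finset.sum_const, Finset.card_univ, Fintype.card_fin, nsmul_eq_mul,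
    ← Finset.expect_sum_comm] at hsum
  have : (γ : ℝ) * (K / (4 * N) * (∑ u, φ u (a u) - B / 2))
      = (∑ u, φ u (a u) - B / 2) / 4 := by
    rw [hγ]; field_simp
  rw [this] at hsum
  linarith

/-- A strategy of one player that is optimal, up to a constant, among all bounded families. -/
theorem exists_meas_forall_le {N γ : ℕ} (hN : 0 < N) {K : ℝ} (hK : 0 < K)
    (hγ : (γ : ℝ) = N / K) {φ : Fin N → A →ₗ[ℝ] ℝ} (hφ : ∀ u a, 0 ≤ a → 0 ≤ φ u a) :
    ∃ P : Fin γ → (Fin γ → Fin N) → A, (∀ α x, 0 ≤ P α x) ∧ (∀ x, ∑ α, P α x ≤ 1) ∧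
      ∀ a, IsBoundedFamily K a →
        ∑ u, φ u (a u) ≤ 16 * 𝔼 x : Fin γ → Fin N, ∑ α, φ (x α) (P α x) := by
  set S : Set ℝ := {r | ∃ a, IsBoundedFamily K a ∧ ∑ u, φ u (a u) = r} with hS
  have h01 : (0 : A) ≤ 1 := by simp
  have h0 : IsBoundedFamily K fun _ : Fin N => (0 : A) :=
    ⟨fun _ => le_rfl, fun _ => by simpa using h01, by simp⟩
  have hSne : (0 : ℝ) ∈ S := ⟨_, h0, by simp⟩
  have hSb : BddAbove S := by
    refine ⟨∑ u, φ u (K⁻¹ • 1), ?_⟩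
    rintro _ ⟨a, ha, rfl⟩
    refine Finset.sum_le_sum fun u _ => ?_
    rw [← sub_nonneg, ← map_sub]
    refine hφ _ _ (sub_nonneg.2 ?_)
    have := smul_le_smul_of_nonneg_left (ha.smul_le_one u) (inv_nonneg.2 hK.le)
    rwa [smul_smul, inv_mul_cancel₀ hK.ne', one_smul] at this
  have hB : ∀ a, IsBoundedFamily K a → ∑ u, φ u (a u) ≤ sSup S := fun a ha =>
    le_csSup hSb ⟨a, ha, rfl⟩
  have hB0 : 0 ≤ sSup S := le_csSup hSb hSne
  -- Any fraction above `1/2` would do: `3/4 - 1/2 = 1/4`, and the factor 4 of `le_expect_seqMeas`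
  -- makes this 16.
  obtain ⟨a, ha, hav⟩ : ∃ a, IsBoundedFamily K a ∧ 3 / 4 * sSup S ≤ ∑ u, φ u (a u) := by
    rcases hB0.eq_or_lt with h | h
    · exact ⟨_, h0, by simp [← h]⟩
    · obtain ⟨_, ⟨a, ha, rfl⟩, hr⟩ := exists_lt_of_lt_csSup ⟨0, hSne⟩
        (show 3 / 4 * sSup S < sSup S by linarith)
      exact ⟨a, ha, hr.le⟩
  have hE0 : ∀ u, 0 ≤ (K / 4) • a u := fun u => smul_nonneg (by positivity) (ha.nonneg u)
  refine ⟨seqMeas fun u => (K / 4) • a u, seqMeas_nonneg hE0,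
    sum_seqMeas_le_one hE0 fun u => ?_, fun a' ha' => ?_⟩
  · have h1 : (K / 4) • a u ≤ K • a u := smul_le_smul_of_nonneg_right (by linarith) (ha.nonneg u)
    exact h1.trans (ha.smul_le_one u)
  · have h1 := le_expect_seqMeas hN hK hγ hφ hB ha
    have h2 := hB a' ha'
    linarith

theorem isBoundedFamily_avgFamily {N γ : ℕ} (hN : 0 < N) {K : ℝ} (hK : 0 < K)
    (hγ : (γ : ℝ) = N / K) {P : Fin γ → (Fin γ → Fin N) → A} (h0 : ∀ α x, 0 ≤ P α x)
    (h1 : ∀ x, ∑ α, P α x ≤ 1) : IsBoundedFamily K (avgFamily P) := by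
  have : Nonempty (Fin N) := ⟨⟨0, hN⟩⟩
  have hN' : (0 : ℝ) < N := by exact_mod_cast hN
  have hcard : (0 : ℝ) < Fintype.card (Fin γ → Fin N) := by exact_mod_cast Fintype.card_pos
  have hle : ∀ α x, P α x ≤ 1 := fun α x =>
    (Finset.single_le_sum (fun β _ => h0 β x) (Finset.mem_univ α)).trans (h1 x)
  refine ⟨fun u => smul_nonneg (by positivity) (Finset.sum_nonneg fun x _ =>
    Finset.sum_nonneg fun α _ => ?_), fun u => ?_, ?_⟩
  · split_ifs
    exacts [h0 _ _, le_rfl]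
  · have hcount : (Fintype.card (Fin γ → Fin N) : ℝ)⁻¹ *
        ∑ x : Fin γ → Fin N, ∑ α, (if x α = u then (1 : ℝ) else 0) = K⁻¹ := by
      have : ∀ α : Fin γ, 𝔼 x : Fin γ → Fin N, (if x α = u then (1 : ℝ) else 0) = (N : ℝ)⁻¹ := by
        intro α
        rw [expect_eval fun v => if v = u then (1 : ℝ) else 0, Fintype.expect_eq_sum_div_card]
        simp
      rw [← div_eq_inv_mul, ← Fintype.expect_eq_sum_div_card, Finset.expect_sum_comm]
      simp only [this, Finset.sum_const, Finset.card_univ, Fintype.card_fin, nsmul_eq_mul]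
      rw [hγ]; field_simp
    have hsum : ∑ x : Fin γ → Fin N, ∑ α, (if x α = u then P α x else 0) ≤
        (∑ x : Fin γ → Fin N, ∑ α, (if x α = u then (1 : ℝ) else 0)) • (1 : A) := by
      simp_rw [Finset.sum_smul]
      refine Finset.sum_le_sum fun x _ => Finset.sum_le_sum fun α _ => ?_
      split_ifs
      · simpa using hle α x
      · simp
    have h2 := smul_le_smul_of_nonneg_left (smul_le_smul_of_nonneg_left hsum
      (inv_nonneg.2 hcard.le)) hK.le
    rwa [smul_smul _ _ (1 : A), hcount, smul_smul _ _ (1 : A), mul_inv_cancel₀ hK.ne',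
      one_smul] at h2
  · simp only [avgFamily]
    rw [← Finset.smul_sum, Finset.sum_comm]
    have hsum : ∑ x : Fin γ → Fin N, ∑ u, ∑ α, (if x α = u then P α x else 0) ≤
        (Fintype.card (Fin γ → Fin N) : ℝ) • (1 : A) := by
      rw [Nat.cast_smul_eq_nsmul ℝ, ← Finset.card_univ, ← Finset.sum_const]
      refine Finset.sum_le_sum fun x _ => ?_
      rw [Finset.sum_comm]
      simpa using h1 x
    have h2 := smul_le_smul_of_nonneg_left hsum (inv_nonneg.2 hcard.le)
    rwa [smul_smul, inv_mul_cancel₀ hcard.ne', one_smul] at h2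

/-! ### Rounding both players. -/

variable {A' : Type*} [CStarAlgebra A'] [PartialOrder A'] [StarOrderedRing A']

/-- Strategies of both players that achieve, up to a constant, the value of a positive bilinear
form on a pair of bounded families. -/
theorem exists_meas_pair {N M γ γ' : ℕ} (hN : 0 < N) (hM : 0 < M) {K K' : ℝ} (hK : 0 < K)
    (hK' : 0 < K') (hγ : (γ : ℝ) = N / K) (hγ' : (γ' : ℝ) = M / K')
    {w : Fin M → Fin N → ℝ} (hw : ∀ v u, 0 ≤ w v u) (β : A' →ₗ[ℝ] A →ₗ[ℝ] ℝ)
    (hβ : ∀ c a, 0 ≤ c → 0 ≤ a → 0 ≤ β c a) {c : Fin M → A'} {a : Fin N → A}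
    (hc : IsBoundedFamily K' c) (ha : IsBoundedFamily K a) :
    ∃ (P : Fin γ → (Fin γ → Fin N) → A) (P' : Fin γ' → (Fin γ' → Fin M) → A'),
      (∀ α x, 0 ≤ P α x) ∧ (∀ x, ∑ α, P α x ≤ 1) ∧ (∀ α y, 0 ≤ P' α y) ∧
      (∀ y, ∑ α, P' α y ≤ 1) ∧
      ∑ v, ∑ u, w v u * β (c v) (a u) ≤
        256 * ∑ v, ∑ u, w v u * β (avgFamily P' v) (avgFamily P u) := by
  obtain ⟨P, hP0, hP1, hP⟩ := exists_meas_forall_le (A := A) hN hK hγ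
    (φ := fun u => ∑ v, w v u • β (c v)) (fun u a ha => by
      simp only [LinearMap.sum_apply, LinearMap.smul_apply, smul_eq_mul]
      exact Finset.sum_nonneg fun v _ => mul_nonneg (hw v u) (hβ _ _ (hc.nonneg v) ha))
  have hPb := isBoundedFamily_avgFamily hN hK hγ hP0 hP1
  -- The second functional is built from the rounded first strategy instead of `a`, so the two
  -- losses multiply.
  obtain ⟨P', hP'0, hP'1, hP'⟩ := exists_meas_forall_le (A := A') hM hK' hγ'
    (φ := fun v => ∑ u, w v u • β.flip (avgFamily P u)) (fun v c hc => by
      simp only [LinearMap.sum_apply, LinearMap.smul_apply, smul_eq_mul]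
      exact Finset.sum_nonneg fun u _ => mul_nonneg (hw v u) (hβ _ _ hc (hPb.nonneg u)))
  refine ⟨P, P', hP0, hP1, hP'0, hP'1, ?_⟩
  have h1 := hP a ha
  have h2 := hP' c hc
  rw [← sum_apply_avgFamily P fun u => ∑ v, w v u • β (c v)] at h1
  rw [← sum_apply_avgFamily P' fun v => ∑ u, w v u • β.flip (avgFamily P u)] at h2
  simp only [LinearMap.sum_apply, LinearMap.smul_apply, smul_eq_mul, LinearMap.flip_apply]
    at h1 h2
  rw [Finset.sum_comm] at h1
  rw [Finset.sum_comm (s := (Finset.univ : Finset (Fin N)))] at h1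
  linarith

end Rounding

/-! ### The condenser as a nonnegative bilinear form -/

/-- The probability that `f_s(u) = v` for a uniform seed `s`. -/
noncomputable def edgeWeight {N M D : ℕ} (f : Fin D → Fin N → Fin M) (v : Fin M) (u : Fin N) : ℝ :=
  𝔼 s, edgeIndicator (neighbor f) u s v

theorem edgeWeight_nonneg {N M D : ℕ} (f : Fin D → Fin N → Fin M) (v : Fin M) (u : Fin N) :
    0 ≤ edgeWeight f v u := by
  refine Finset.expect_nonneg fun s _ => ?_
  unfold edgeIndicator
  split_ifs <;> norm_num

theorem conMap_apply {N M D : ℕ} (f : Fin D → Fin N → Fin M) (x : Fin N → ℂ) (v : Fin M) :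
    conMap f x v = ∑ u, (edgeWeight f v u : ℂ) * x u := by
  have h : ∀ s u, ((edgeIndicator (neighbor f) u s v : ℝ) : ℂ) = functionMatrix (f s) v u := by
    intro s u
    by_cases h : f s u = v <;> simp [edgeIndicator, neighbor, functionMatrix, h]
  simp only [conMap, Matrix.mulVecLin_apply, Matrix.mulVec, dotProduct, Matrix.smul_apply,
    Matrix.sum_apply, edgeWeight, Fintype.expect_eq_sum_div_card, Fintype.card_fin]
  refine Finset.sum_congr rfl fun u _ => ?_
  push_cast
  simp only [h]
  rw [smul_eq_mul, div_eq_inv_mul]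

theorem amplification_conMap {N M D : ℕ} (f : Fin D → Fin N → Fin M) {Q : ℕ} (x : MatOver Q N)
    (v : Fin M) : amplification (conMap f) x v = ∑ u, edgeWeight f v u • x u := by
  ext i j
  simp [amplification, conMap_apply, Matrix.sum_apply]

theorem expect_game {N M D γ γ' : ℕ} (f : Fin D → Fin N → Fin M)
    (t : Fin γ → (Fin γ → Fin N) → Fin γ' → (Fin γ' → Fin M) → ℝ) :
    (𝔼 s : Fin D, 𝔼 x : Fin γ → Fin N, 𝔼 y : Fin γ' → Fin M, ∑ α, ∑ β,
      edgeIndicator (neighbor f) (x α) s (y β) * t α x β y) =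
    𝔼 x : Fin γ → Fin N, ∑ α, 𝔼 y : Fin γ' → Fin M, ∑ β,
      edgeWeight f (y β) (x α) * t α x β y := by
  rw [Finset.expect_comm]
  refine Finset.expect_congr rfl fun x _ => ?_
  rw [Finset.expect_comm, ← Finset.expect_sum_comm]
  refine Finset.expect_congr rfl fun y _ => ?_
  rw [Finset.expect_sum_comm]
  refine Finset.sum_congr rfl fun α _ => ?_
  rw [Finset.expect_sum_comm]
  refine Finset.sum_congr rfl fun β _ => ?_
  rw [edgeWeight, Finset.expect_mul]

theorem sum_weight_avgFamily {A A' : Type*} [CStarAlgebra A] [CStarAlgebra A'] {N M γ γ' : ℕ}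
    (w : Fin M → Fin N → ℝ) (β : A' →ₗ[ℝ] A →ₗ[ℝ] ℝ) (P : Fin γ → (Fin γ → Fin N) → A)
    (P' : Fin γ' → (Fin γ' → Fin M) → A') :
    ∑ v, ∑ u, w v u * β (avgFamily P' v) (avgFamily P u) =
      𝔼 x : Fin γ → Fin N, ∑ α, 𝔼 y : Fin γ' → Fin M, ∑ b, w (y b) (x α) *
        β (P' b y) (P α x) := by
  rw [Finset.sum_comm]
  have h1 := sum_apply_avgFamily P fun u => ∑ v, w v u • β (avgFamily P' v)
  simp only [LinearMap.sum_apply, LinearMap.smul_apply, smul_eq_mul] at h1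
  rw [h1]
  refine Finset.expect_congr rfl fun x _ => Finset.sum_congr rfl fun α _ => ?_
  exact sum_apply_avgFamily P' fun v => w v (x α) • β.flip (P α x)

/-! ### Matrices, operator norms and quadratic forms -/

section Matrices

open scoped MatrixOrder Matrix.Norms.L2Operator

/-- The form `(X, Y) ↦ Re ⟨ψ, (X ⊗ Y) ψ⟩`. -/
noncomputable def kronForm {R Q : ℕ} (ψ : Fin R × Fin Q → ℂ) :
    Matrix (Fin R) (Fin R) ℂ →ₗ[ℝ] Matrix (Fin Q) (Fin Q) ℂ →ₗ[ℝ] ℝ :=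
  LinearMap.mk₂ ℝ (fun X Y => (star ψ ⬝ᵥ ((X ⊗ₖ Y) *ᵥ ψ)).re)
    (fun X X' Y => by rw [Matrix.add_kronecker, Matrix.add_mulVec, dotProduct_add, Complex.add_re])
    (fun r X Y => by
      rw [Matrix.smul_kronecker, Matrix.smul_mulVec, dotProduct_smul, Complex.smul_re])
    (fun X Y Y' => by
      rw [Matrix.kronecker_add, Matrix.add_mulVec, dotProduct_add, Complex.add_re])
    (fun r X Y => by
      rw [Matrix.kronecker_smul, Matrix.smul_mulVec, dotProduct_smul, Complex.smul_re])

theorem kronForm_apply {R Q : ℕ} (ψ : Fin R × Fin Q → ℂ) (X : Matrix (Fin R) (Fin R) ℂ)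
    (Y : Matrix (Fin Q) (Fin Q) ℂ) :
    kronForm ψ X Y = (star ψ ⬝ᵥ ((X ⊗ₖ Y) *ᵥ ψ)).re := rfl

theorem kronForm_nonneg {R Q : ℕ} (ψ : Fin R × Fin Q → ℂ) (X : Matrix (Fin R) (Fin R) ℂ)
    (Y : Matrix (Fin Q) (Fin Q) ℂ) (hX : 0 ≤ X) (hY : 0 ≤ Y) : 0 ≤ kronForm ψ X Y :=
  (Complex.le_def.1 (((Matrix.nonneg_iff_posSemidef.1 hX).kronecker
    (Matrix.nonneg_iff_posSemidef.1 hY)).dotProduct_mulVec_nonneg ψ)).1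

/-- Reconciles two conventions: the game puts Alice in the first tensor factor, the dual norm puts
the `M` side there. -/
theorem kronForm_swap {R Q : ℕ} (ψ : Fin Q × Fin R → ℂ) (X : Matrix (Fin R) (Fin R) ℂ)
    (Y : Matrix (Fin Q) (Fin Q) ℂ) :
    (star ψ ⬝ᵥ ((Y ⊗ₖ X) *ᵥ ψ)).re = kronForm (ψ ∘ Prod.swap) X Y := by
  rw [kronForm_apply]
  congr 1
  simp only [dotProduct, Matrix.mulVec]
  refine Fintype.sum_equiv (Equiv.prodComm _ _) _ _ fun p => ?_
  congr 1
  refine Fintype.sum_equiv (Equiv.prodComm _ _) _ _ fun q => ?_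
  simp [Matrix.kroneckerMap_apply, mul_comm]

/-- The squared Euclidean norm. -/
noncomputable def normSqVec {n : Type} [Fintype n] (φ : n → ℂ) : ℝ := (star φ ⬝ᵥ φ).re

theorem normSqVec_eq {n : Type} [Fintype n] (φ : n → ℂ) :
    normSqVec φ = ‖(WithLp.toLp 2 φ : EuclideanSpace ℂ n)‖ ^ 2 := by
  rw [EuclideanSpace.norm_sq_eq, normSqVec, dotProduct, Complex.re_sum]
  refine Finset.sum_congr rfl fun i _ => ?_
  simp [← Complex.normSq_eq_norm_sq, Complex.normSq_apply]

theorem normSqVec_nonneg {n : Type} [Fintype n] (φ : n → ℂ) : 0 ≤ normSqVec φ := by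
  rw [normSqVec_eq]; positivity

theorem sqrt_normSqVec {n : Type} [Fintype n] (φ : n → ℂ) :
    √(normSqVec φ) = ‖(WithLp.toLp 2 φ : EuclideanSpace ℂ n)‖ := by
  rw [normSqVec_eq, Real.sqrt_sq (norm_nonneg _)]

theorem norm_dotProduct_le {n : Type} [Fintype n] (φ ψ : n → ℂ) :
    ‖star φ ⬝ᵥ ψ‖ ≤ √(normSqVec φ) * √(normSqVec ψ) := by
  rw [sqrt_normSqVec, sqrt_normSqVec]
  have := norm_inner_le_norm (𝕜 := ℂ) (WithLp.toLp 2 φ : EuclideanSpace ℂ n) (WithLp.toLp 2 ψ)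
  rwa [EuclideanSpace.inner_eq_star_dotProduct, dotProduct_comm] at this

theorem norm_mulVec_le {m n : Type} [Fintype m] [Fintype n] [DecidableEq n]
    (T : Matrix m n ℂ) (ψ : n → ℂ) :
    √(normSqVec (T *ᵥ ψ)) ≤ opNorm T * √(normSqVec ψ) := by
  rw [sqrt_normSqVec, sqrt_normSqVec]
  exact Matrix.l2_opNorm_mulVec T (WithLp.toLp 2 ψ)

theorem opNorm_le_of_forall {m n : Type} [Fintype m] [Fintype n] [DecidableEq n]
    {T : Matrix m n ℂ} {B : ℝ} (hB : 0 ≤ B)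
    (h : ∀ φ ψ, ‖star φ ⬝ᵥ T *ᵥ ψ‖ ≤ B * (√(normSqVec φ) * √(normSqVec ψ))) : opNorm T ≤ B := by
  rw [opNorm, Matrix.l2_opNorm_def]
  refine ContinuousLinearMap.opNorm_le_bound _ hB fun ψ => ?_
  have h1 := h (T *ᵥ ψ.ofLp) ψ.ofLp
  have h2 : normSqVec (T *ᵥ ψ.ofLp) ≤ ‖star (T *ᵥ ψ.ofLp) ⬝ᵥ T *ᵥ ψ.ofLp‖ :=
    (le_abs_self _).trans (Complex.abs_re_le_norm _)
  have h3 : √(normSqVec (T *ᵥ ψ.ofLp)) ≤ B * √(normSqVec ψ.ofLp) := by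
    rcases (Real.sqrt_nonneg (normSqVec (T *ᵥ ψ.ofLp))).eq_or_lt with h0 | h0
    · rw [← h0]; positivity
    · have h4 := Real.mul_self_sqrt (normSqVec_nonneg (T *ᵥ ψ.ofLp))
      refine le_of_mul_le_mul_left ?_ h0
      calc _ ≤ _ := h4.le.trans (h2.trans h1)
        _ = _ := by ring
  rw [sqrt_normSqVec, sqrt_normSqVec] at h3
  exact h3

theorem opNorm_nonneg {m n : Type} [Fintype m] [Fintype n] [DecidableEq n] (T : Matrix m n ℂ) :
    0 ≤ opNorm T := norm_nonneg _

theorem mul_conjTranspose_le_iff {m n : Type} [Fintype m] [Fintype n] [DecidableEq n]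
    [DecidableEq m] (T : Matrix m n ℂ) {s : ℝ} (hs : 0 ≤ s) :
    T * Tᴴ ≤ (s ^ 2) • (1 : Matrix m m ℂ) ↔ opNorm T ≤ s := by
  have h0 : 0 ≤ T * Tᴴ := (Matrix.posSemidef_self_mul_conjTranspose T).nonneg
  have h1 : ‖T * Tᴴ‖ = opNorm T ^ 2 := by
    have := Matrix.l2_opNorm_conjTranspose_mul_self (𝕜 := ℂ) Tᴴ
    rwa [Matrix.conjTranspose_conjTranspose, Matrix.l2_opNorm_conjTranspose, ← sq] at this
  rw [← Algebra.algebraMap_eq_smul_one,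
    ← CStarAlgebra.norm_le_iff_le_algebraMap _ (by positivity) h0, h1]
  exact pow_le_pow_iff_left₀ (opNorm_nonneg T) hs two_ne_zero

/-! ### Compression to a smaller dimension -/

theorem IsBoundedFamily.compress {ι : Type*} [Fintype ι] {R Q : ℕ} {K : ℝ}
    {C : ι → Matrix (Fin R) (Fin R) ℂ} (hC : IsBoundedFamily K C) {V : Matrix (Fin R) (Fin Q) ℂ}
    (hV : Vᴴ * V ≤ 1) : IsBoundedFamily K fun v => Vᴴ * C v * V := by
  have hmono : ∀ {X Y : Matrix (Fin R) (Fin R) ℂ}, X ≤ Y → Vᴴ * X * V ≤ Vᴴ * Y * V := by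
    intro X Y h
    rw [Matrix.le_iff] at h ⊢
    have := h.conjTranspose_mul_mul_same V
    rwa [Matrix.mul_sub, Matrix.sub_mul] at this
  have hV' : Vᴴ * (1 : Matrix (Fin R) (Fin R) ℂ) * V ≤ 1 := by rwa [Matrix.mul_one]
  refine ⟨fun v => by simpa using hmono (hC.nonneg v), fun v => ?_, ?_⟩
  · have := (hmono (hC.smul_le_one v)).trans hV'
    rwa [Matrix.mul_smul, Matrix.smul_mul] at this
  · have := (hmono hC.sum_le_one).trans hV'
    rwa [Matrix.mul_sum, Matrix.sum_mul] at this

theorem kronForm_mulVec {R Q : ℕ} (V : Matrix (Fin R) (Fin Q) ℂ) (φ : Fin Q × Fin Q → ℂ)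
    (X : Matrix (Fin R) (Fin R) ℂ) (Y : Matrix (Fin Q) (Fin Q) ℂ) :
    kronForm ((V ⊗ₖ (1 : Matrix (Fin Q) (Fin Q) ℂ)) *ᵥ φ) X Y = kronForm φ (Vᴴ * X * V) Y := by
  rw [kronForm_apply, kronForm_apply, Matrix.star_mulVec, ← Matrix.dotProduct_mulVec,
    Matrix.mulVec_mulVec, Matrix.mulVec_mulVec, Matrix.conjTranspose_kronecker,
    ← Matrix.mul_kronecker_mul, ← Matrix.mul_kronecker_mul, Matrix.conjTranspose_one,
    Matrix.one_mul, Matrix.mul_one, Matrix.mul_assoc]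

/-- Read `φ` as an `R × Q` matrix `Φ` and take an approximate polar decomposition `Φ = V B` with `B*
B = Φ* Φ + ε`. The `ε` makes `B` invertible, so `V = Φ B⁻¹` is a contraction, and costs `Q ε` in the
trace. -/
theorem exists_compression {R Q : ℕ} (φ : Fin R × Fin Q → ℂ) {ε : ℝ} (hε : 0 < ε) :
    ∃ (V : Matrix (Fin R) (Fin Q) ℂ) (φ' : Fin Q × Fin Q → ℂ), Vᴴ * V ≤ 1 ∧
      φ = (V ⊗ₖ (1 : Matrix (Fin Q) (Fin Q) ℂ)) *ᵥ φ' ∧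
      normSqVec φ' = normSqVec φ + Q * ε := by
  set Φ : Matrix (Fin R) (Fin Q) ℂ := Matrix.of fun r q => φ (r, q) with hΦ
  have hpos : (Φᴴ * Φ + ε • (1 : Matrix (Fin Q) (Fin Q) ℂ)).PosDef :=
    Matrix.PosDef.posSemidef_add (Matrix.posSemidef_conjTranspose_mul_self Φ)
      (Matrix.PosDef.one.smul hε)
  obtain ⟨B, hB, hBM⟩ := CStarAlgebra.isStrictlyPositive_iff_eq_star_mul_self.mp
    hpos.isStrictlyPositive
  rw [Matrix.star_eq_conjTranspose] at hBM
  have hdet : IsUnit B.det := (Matrix.isUnit_iff_isUnit_det B).1 hB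
  have hVB : Φ * B⁻¹ * B = Φ := by rw [Matrix.mul_assoc, Matrix.nonsing_inv_mul _ hdet, Matrix.mul_one]
  refine ⟨Φ * B⁻¹, fun p => B p.1 p.2, ?_, ?_, ?_⟩
  · have h1 : Φᴴ * Φ ≤ Bᴴ * B := by
      rw [← hBM]
      exact le_add_of_nonneg_right (smul_nonneg hε.le Matrix.PosSemidef.one.nonneg)
    rw [Matrix.le_iff] at h1 ⊢
    have h2 := h1.conjTranspose_mul_mul_same B⁻¹
    rw [Matrix.mul_sub, Matrix.sub_mul] at h2
    convert h2 using 2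
    · rw [← Matrix.mul_assoc, ← Matrix.conjTranspose_mul, Matrix.mul_nonsing_inv _ hdet,
        Matrix.conjTranspose_one, Matrix.one_mul, Matrix.mul_nonsing_inv _ hdet]
    · rw [Matrix.conjTranspose_mul]
      simp only [Matrix.mul_assoc]
  · ext ⟨r, q⟩
    have := congrFun (congrFun hVB r) q
    rw [Matrix.mul_apply] at this
    simp only [Matrix.mulVec, dotProduct, Fintype.sum_prod_type, Matrix.kroneckerMap_apply,
      Matrix.one_apply]
    simp only [mul_ite, ite_mul, mul_one, mul_zero, zero_mul, Finset.sum_ite_eq,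
      Finset.mem_univ, if_true, this]
    rfl
  · have htr : ∀ {m : ℕ} (X : Matrix (Fin m) (Fin Q) ℂ),
        normSqVec (fun p : Fin m × Fin Q => X p.1 p.2) = (Xᴴ * X).trace.re := by
      intro m X
      rw [normSqVec, dotProduct, Fintype.sum_prod_type_right]
      simp [Matrix.trace, Matrix.mul_apply]
    rw [htr, ← hBM, Matrix.trace_add, Complex.add_re, ← htr, Matrix.trace_smul, Matrix.trace_one]
    simp [hΦ, mul_comm]

/-! ### Bounded families from factorizations -/

/-- Factor each block as `s s*` and let `S` be block diagonal. Then `S S*` is the block diagonal of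
`a` and the reshuffled `S` times its adjoint is `∑ a(u)`, so the two constraints on the family bound
the two factor norms. -/
theorem capCap_le_one {Q N : ℕ} {K : ℝ} (hK : 0 < K) {a : MatOver Q N} (ha : IsBoundedFamily K a) :
    capCap N K Q a ≤ 1 := by
  choose s hs using fun u => CStarAlgebra.nonneg_iff_eq_mul_star_self.mp (ha.nonneg u)
  simp only [Matrix.star_eq_conjTranspose] at hs
  set S := Matrix.blockDiagonal s with hS
  have hSS : S * Sᴴ = Matrix.blockDiagonal a := by
    rw [hS, Matrix.blockDiagonal_conjTranspose, ← Matrix.blockDiagonal_mul]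
    congr 1
    exact (funext hs).symm
  have h1 : √K * opNorm S ≤ 1 := by
    have h2 : opNorm S ≤ (√K)⁻¹ := by
      rw [← mul_conjTranspose_le_iff _ (by positivity), hSS, inv_pow, Real.sq_sqrt hK.le,
        Matrix.le_iff]
      choose t ht using fun u => CStarAlgebra.nonneg_iff_eq_mul_star_self.mp
        (sub_nonneg.2 (ha.smul_le_one u))
      have h3 : K⁻¹ • (1 : Matrix (Fin Q × Fin N) (Fin Q × Fin N) ℂ) - Matrix.blockDiagonal a =
          K⁻¹ • (Matrix.blockDiagonal t * (Matrix.blockDiagonal t)ᴴ) := by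
        rw [Matrix.blockDiagonal_conjTranspose, ← Matrix.blockDiagonal_mul]
        have : (fun k => t k * (t k)ᴴ) = 1 - K • a := funext fun u => (ht u).symm
        rw [this, Matrix.blockDiagonal_sub, Matrix.blockDiagonal_one, Matrix.blockDiagonal_smul,
          smul_sub, smul_smul, inv_mul_cancel₀ hK.ne', one_smul]
      rw [h3]
      exact (Matrix.posSemidef_self_mul_conjTranspose _).smul (inv_nonneg.2 hK.le)
    calc √K * opNorm S ≤ √K * (√K)⁻¹ := by gcongr
      _ = 1 := mul_inv_cancel₀ (by positivity)
  have h2 : opNorm (reshuffle S) ≤ 1 := by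
    rw [← mul_conjTranspose_le_iff _ zero_le_one, one_pow, one_smul]
    refine le_of_eq_of_le ?_ ha.sum_le_one
    simp_rw [hs]
    ext i j
    simp only [Matrix.mul_apply, reshuffle, Matrix.of_apply, Matrix.conjTranspose_apply,
      Fintype.sum_prod_type, Matrix.sum_apply, hS, Matrix.blockDiagonal_apply]
    rw [Finset.sum_comm]
    simp
  refine (iInf₂_le_of_le S S (iInf_le_of_le hSS ?_))
  rw [← ENNReal.ofReal_one]
  refine ENNReal.ofReal_le_ofReal ?_
  have h3 : factorNorm K S ≤ 1 := max_le h1 h2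
  have h4 : 0 ≤ factorNorm K S := (opNorm_nonneg _).trans (le_max_right _ _)
  exact mul_le_one₀ h3 h4 h3

/-- The rows of `a` that belong to the block `u`. -/
def rowBlock {Q N : ℕ} (a : Matrix (Fin Q × Fin N) (Fin Q × Fin N) ℂ) (u : Fin N) :
    Matrix (Fin Q) (Fin Q × Fin N) ℂ :=
  a.submatrix (fun i => (i, u)) id

theorem rowBlock_mul_conjTranspose {Q N : ℕ} (a b : Matrix (Fin Q × Fin N) (Fin Q × Fin N) ℂ)
    (u : Fin N) : rowBlock a u * (rowBlock b u)ᴴ =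
      (a * bᴴ).submatrix (fun i => (i, u)) (fun i => (i, u)) := by
  ext i j
  simp [rowBlock, Matrix.mul_apply]

/-- Converse direction, for factors that need not be block diagonal: the products of row blocks are
diagonal blocks of `a a*`, and their sum is the reshuffled `a` times its adjoint. -/
theorem isBoundedFamily_rowBlock {Q N : ℕ} {K : ℝ} (hK : 0 < K)
    {a : Matrix (Fin Q × Fin N) (Fin Q × Fin N) ℂ} {s : ℝ} (hs : 0 < s)
    (ha : factorNorm K a ≤ s) :
    IsBoundedFamily K fun u => (s ^ 2)⁻¹ • (rowBlock a u * (rowBlock a u)ᴴ) := by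
  have hs2 : 0 < s ^ 2 := by positivity
  have h1 : opNorm a ≤ s / √K := by
    rw [le_div_iff₀ (by positivity), mul_comm]
    exact (le_max_left _ _).trans ha
  have h2 : opNorm (reshuffle a) ≤ s := (le_max_right _ _).trans ha
  rw [← mul_conjTranspose_le_iff _ (by positivity)] at h1 h2
  rw [div_pow, Real.sq_sqrt hK.le] at h1
  refine ⟨fun u => smul_nonneg (by positivity)
    (Matrix.posSemidef_self_mul_conjTranspose _).nonneg, fun u => ?_, ?_⟩
  · have h3 := smul_le_smul_of_nonneg_left h1 (show 0 ≤ K * (s ^ 2)⁻¹ by positivity)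
    rw [smul_smul _ _ (1 : Matrix _ _ ℂ), show K * (s ^ 2)⁻¹ * (s ^ 2 / K) = 1 by field_simp,
      one_smul, Matrix.le_iff] at h3
    have h4 := h3.submatrix fun i : Fin Q => (i, u)
    rw [smul_smul, Matrix.le_iff, rowBlock_mul_conjTranspose]
    convert h4 using 1
    ext i j
    simp [Matrix.one_apply]
  · have h3 := smul_le_smul_of_nonneg_left h2 (inv_nonneg.2 hs2.le)
    rw [smul_smul _ _ (1 : Matrix _ _ ℂ), inv_mul_cancel₀ hs2.ne', one_smul] at h3
    rw [← Finset.smul_sum]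
    refine le_of_eq_of_le ?_ h3
    congr 1
    ext i j
    simp only [Matrix.mul_apply, reshuffle, Matrix.of_apply, Matrix.conjTranspose_apply,
      Fintype.sum_prod_type, Matrix.sum_apply, rowBlock, Matrix.submatrix_apply, id]
    rw [Finset.sum_comm]

theorem exists_factorization {Q N : ℕ} {K : ℝ} {x : MatOver Q N} (hx : capCap N K Q x ≤ 1)
    {η : ℝ} (hη : 1 < η) : ∃ (a b : Matrix (Fin Q × Fin N) (Fin Q × Fin N) ℂ) (s t : ℝ),
      a * bᴴ = Matrix.blockDiagonal x ∧ 0 < s ∧ 0 < t ∧ factorNorm K a ≤ s ∧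
      factorNorm K b ≤ t ∧ s * t ≤ η := by
  have h1 : capCap N K Q x < ENNReal.ofReal η :=
    hx.trans_lt (by rw [← ENNReal.ofReal_one]; exact (ENNReal.ofReal_lt_ofReal_iff (by linarith)).2 hη)
  rw [capCap] at h1
  simp only [iInf_lt_iff] at h1
  obtain ⟨a, b, hab, hlt⟩ := h1
  rw [ENNReal.ofReal_lt_ofReal_iff (by linarith)] at hlt
  have hcont : Filter.Tendsto (fun δ : ℝ => (factorNorm K a + δ) * (factorNorm K b + δ))
      (nhdsWithin 0 (Set.Ioi 0)) (nhds (factorNorm K a * factorNorm K b)) := by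
    have : Continuous fun δ : ℝ => (factorNorm K a + δ) * (factorNorm K b + δ) := by fun_prop
    simpa using (this.tendsto 0).mono_left nhdsWithin_le_nhds
  -- A small `δ` added to both factor norms makes them strictly positive, as rescaling requires,
  -- even if one of them vanishes.
  obtain ⟨δ, hδ, hδ0⟩ := ((hcont.eventually_lt_const hlt).and self_mem_nhdsWithin).exists
  have hδ0 : 0 < δ := hδ0
  have ha0 : 0 ≤ factorNorm K a := (opNorm_nonneg _).trans (le_max_right _ _)
  have hb0 : 0 ≤ factorNorm K b := (opNorm_nonneg _).trans (le_max_right _ _)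
  exact ⟨a, b, _, _, hab, by linarith, by linarith, by linarith, by linarith, hδ.le⟩

end Matrices

/-! ### The entangled value and the amplified norms -/

section Entangled

open scoped MatrixOrder Matrix.Norms.L2Operator

theorem inv_mul_amplifiedNorm {N M : ℕ} {K' : ℝ} (hK' : 0 < K') (E : MatNorms N) (Q : ℕ)
    (u : (Fin N → ℂ) →ₗ[ℂ] (Fin M → ℂ)) :
    ENNReal.ofReal K'⁻¹ * amplifiedNorm E (sigmaSigma M K') Q u =
      ⨆ (x : MatOver Q N) (_ : E Q x ≤ 1) (R : ℕ) (z : MatOver R M) (_ : capCap M K' R z ≤ 1),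
        ENNReal.ofReal (opNorm (∑ v, z v ⊗ₖ amplification u x v)) := by
  have h : ENNReal.ofReal K'⁻¹ * ENNReal.ofReal K' = 1 := by
    rw [← ENNReal.ofReal_mul (by positivity), inv_mul_cancel₀ hK'.ne', ENNReal.ofReal_one]
  simp only [amplifiedNorm, sigmaSigma, ENNReal.mul_iSup, ← mul_assoc, h, one_mul]
  rfl

theorem sum_weight_kronForm {N M D R Q : ℕ} (f : Fin D → Fin N → Fin M)
    (φ : Fin R × Fin Q → ℂ) (C : MatOver R M) (A : MatOver Q N) :
    ∑ v, ∑ u, edgeWeight f v u * kronForm φ (C v) (A u) =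
      (star φ ⬝ᵥ ((∑ v, C v ⊗ₖ amplification (conMap f) A v) *ᵥ φ)).re := by
  rw [Matrix.sum_mulVec, dotProduct_sum, Complex.re_sum]
  refine Finset.sum_congr rfl fun v _ => ?_
  rw [← kronForm_apply, amplification_conMap, map_sum]
  simp

theorem gameValue_eq {N M D γ γ' Q : ℕ} (f : Fin D → Fin N → Fin M) (ψ : Fin Q × Fin Q → ℂ)
    (p : Fin γ → (Fin γ → Fin N) → Matrix (Fin Q) (Fin Q) ℂ)
    (q : Fin γ' → (Fin γ' → Fin M) → Matrix (Fin Q) (Fin Q) ℂ) :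
    (𝔼 s : Fin D, 𝔼 x : Fin γ → Fin N, 𝔼 y : Fin γ' → Fin M,
      ∑ α, ∑ β, edgeIndicator (neighbor f) (x α) s (y β) *
        (star ψ ⬝ᵥ ((p α x ⊗ₖ q β y) *ᵥ ψ)).re) =
    ∑ v, ∑ u, edgeWeight f v u * kronForm (ψ ∘ Prod.swap) (avgFamily q v) (avgFamily p u) := by
  rw [sum_weight_avgFamily, expect_game f fun α x β y => (star ψ ⬝ᵥ ((p α x ⊗ₖ q β y) *ᵥ ψ)).re]
  simp only [kronForm_swap]

theorem star_dotProduct_swap {R Q : ℕ} (ψ : Fin R × Fin Q → ℂ) :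
    star (ψ ∘ Prod.swap) ⬝ᵥ (ψ ∘ Prod.swap) = star ψ ⬝ᵥ ψ :=
  Fintype.sum_equiv (Equiv.prodComm _ _) _ _ fun _ => rfl

theorem star_dotProduct_self {n : Type} [Fintype n] (φ : n → ℂ) :
    star φ ⬝ᵥ φ = (normSqVec φ : ℂ) := by
  have h := (Complex.le_def.1 (dotProduct_star_self_nonneg φ)).2
  exact Complex.ext rfl (by simpa using h.symm)

theorem entangledValueDim_le {N M D γ γ' : ℕ} (hN : 0 < N) (hM : 0 < M)
    (f : Fin D → Fin N → Fin M) {K K' : ℝ} (hK : 0 < K) (hK' : 0 < K') (hγ : (γ : ℝ) = N / K)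
    (hγ' : (γ' : ℝ) = M / K') (Q : ℕ) :
    entangledValueDim (neighbor f) γ γ' Q ≤
      ENNReal.ofReal K'⁻¹ * amplifiedNorm (capCap N K) (sigmaSigma M K') Q (conMap f) := by
  rw [inv_mul_amplifiedNorm hK']
  refine iSup₂_le fun ψ hψ => iSup₂_le fun p hp => iSup₂_le fun q hq => ?_
  have hx := isBoundedFamily_avgFamily hN hK hγ (fun α x => (hp.1 α x).nonneg) hp.2
  have hz := isBoundedFamily_avgFamily hM hK' hγ' (fun α x => (hq.1 α x).nonneg) hq.2
  refine le_iSup₂_of_le _ (capCap_le_one hK hx) (le_iSup_of_le Q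
    (le_iSup₂_of_le _ (capCap_le_one hK' hz) (ENNReal.ofReal_le_ofReal ?_)))
  rw [gameValue_eq, sum_weight_kronForm]
  set φ := ψ ∘ Prod.swap with hφ
  have hφ1 : normSqVec φ = 1 := by rw [normSqVec, hφ, star_dotProduct_swap, hψ, Complex.one_re]
  set T := ∑ v, avgFamily q v ⊗ₖ amplification (conMap f) (avgFamily p) v
  calc (star φ ⬝ᵥ T *ᵥ φ).re ≤ ‖star φ ⬝ᵥ T *ᵥ φ‖ := Complex.re_le_norm _
    _ ≤ √(normSqVec φ) * √(normSqVec (T *ᵥ φ)) := norm_dotProduct_le _ _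
    _ ≤ √(normSqVec φ) * (opNorm T * √(normSqVec φ)) := by
      gcongr
      exact norm_mulVec_le _ _
    _ = opNorm T := by simp [hφ1]

theorem kronForm_smul_vec {R Q : ℕ} (r : ℝ) (φ : Fin R × Fin Q → ℂ)
    (X : Matrix (Fin R) (Fin R) ℂ) (Y : Matrix (Fin Q) (Fin Q) ℂ) :
    kronForm (r • φ) X Y = r ^ 2 * kronForm φ X Y := by
  rw [kronForm_apply, kronForm_apply, Matrix.mulVec_smul, star_smul, smul_dotProduct,
    dotProduct_smul, star_trivial, Complex.smul_re, Complex.smul_re]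
  simp only [smul_eq_mul]
  ring

theorem normSqVec_smul {n : Type} [Fintype n] (r : ℝ) (φ : n → ℂ) :
    normSqVec (r • φ) = r ^ 2 * normSqVec φ := by
  rw [normSqVec, normSqVec, star_smul, smul_dotProduct, dotProduct_smul, star_trivial,
    Complex.smul_re, Complex.smul_re]
  simp only [smul_eq_mul]
  ring

/-! ### From the amplified norm back to entangled strategies. -/

section Rounding

variable {N M D γ γ' : ℕ} {K K' : ℝ} {Q : ℕ}

theorem form_le_of_square (hN : 0 < N) (hM : 0 < M) (f : Fin D → Fin N → Fin M) (hK : 0 < K)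
    (hK' : 0 < K') (hγ : (γ : ℝ) = N / K) (hγ' : (γ' : ℝ) = M / K')
    (hω : entangledValueDim (neighbor f) γ γ' Q ≠ ⊤) {C : MatOver Q M} {A : MatOver Q N}
    (hC : IsBoundedFamily K' C) (hA : IsBoundedFamily K A) (φ : Fin Q × Fin Q → ℂ) :
    ∑ v, ∑ u, edgeWeight f v u * kronForm φ (C v) (A u) ≤
      256 * (entangledValueDim (neighbor f) γ γ' Q).toReal * normSqVec φ := by
  rcases (normSqVec_nonneg φ).eq_or_lt with h0 | h0
  · have hφ : φ = 0 := by
      have : star φ ⬝ᵥ φ = 0 := by rw [star_dotProduct_self, ← h0, Complex.ofReal_zero]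
      exact dotProduct_star_self_eq_zero.1 this
    rw [← h0, hφ]
    simp [kronForm_apply]
  · set r := √(normSqVec φ) with hr
    have hr0 : 0 < r := Real.sqrt_pos.2 h0
    have hr2 : r ^ 2 = normSqVec φ := Real.sq_sqrt h0.le
    set ψ : Fin Q × Fin Q → ℂ := r⁻¹ • φ with hψ
    have hφψ : φ = r • ψ := by rw [hψ, smul_smul, mul_inv_cancel₀ hr0.ne', one_smul]
    have hψ1 : normSqVec ψ = 1 := by
      rw [hψ, normSqVec_smul, ← hr2, inv_pow, inv_mul_cancel₀ (by positivity)]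
    obtain ⟨P, P', hP0, hP1, hP'0, hP'1, h⟩ := exists_meas_pair hN hM hK hK' hγ hγ'
      (edgeWeight_nonneg f) (kronForm ψ) (kronForm_nonneg ψ) hC hA
    have hgame := gameValue_eq f (ψ ∘ Prod.swap) P P'
    have hswap : (ψ ∘ Prod.swap) ∘ Prod.swap = ψ := by ext ⟨_, _⟩; rfl
    rw [hswap] at hgame
    have hle : ∑ v, ∑ u, edgeWeight f v u * kronForm ψ (avgFamily P' v) (avgFamily P u) ≤
        (entangledValueDim (neighbor f) γ γ' Q).toReal := by
      rw [← ENNReal.ofReal_le_iff_le_toReal hω, ← hgame]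
      exact le_iSup₂_of_le (ψ ∘ Prod.swap)
        (by rw [star_dotProduct_swap, star_dotProduct_self, hψ1, Complex.ofReal_one])
        (le_iSup₂_of_le P ⟨fun α x => Matrix.nonneg_iff_posSemidef.1 (hP0 α x), hP1⟩
          (le_iSup₂_of_le P' ⟨fun α x => Matrix.nonneg_iff_posSemidef.1 (hP'0 α x), hP'1⟩ le_rfl))
    have hscale : ∑ v, ∑ u, edgeWeight f v u * kronForm φ (C v) (A u) =
        r ^ 2 * ∑ v, ∑ u, edgeWeight f v u * kronForm ψ (C v) (A u) := by
      rw [hφψ]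
      simp only [kronForm_smul_vec, Finset.mul_sum]
      refine Finset.sum_congr rfl fun v _ => Finset.sum_congr rfl fun u _ => ?_
      ring
    rw [hscale, ← hr2, mul_comm]
    gcongr
    linarith

/-- Compressing the `R` side to dimension `Q` keeps the family bounded; then `ε → 0` removes the
excess norm. -/
theorem form_le (hN : 0 < N) (hM : 0 < M) (f : Fin D → Fin N → Fin M) (hK : 0 < K)
    (hK' : 0 < K') (hγ : (γ : ℝ) = N / K) (hγ' : (γ' : ℝ) = M / K')
    (hω : entangledValueDim (neighbor f) γ γ' Q ≠ ⊤) {R : ℕ} {C : MatOver R M} {A : MatOver Q N}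
    (hC : IsBoundedFamily K' C) (hA : IsBoundedFamily K A) (φ : Fin R × Fin Q → ℂ) :
    ∑ v, ∑ u, edgeWeight f v u * kronForm φ (C v) (A u) ≤
      256 * (entangledValueDim (neighbor f) γ γ' Q).toReal * normSqVec φ := by
  set V := 256 * (entangledValueDim (neighbor f) γ γ' Q).toReal
  have h : ∀ ε : ℝ, 0 < ε → ∑ v, ∑ u, edgeWeight f v u * kronForm φ (C v) (A u) ≤
      V * (normSqVec φ + Q * ε) := by
    intro ε hε
    obtain ⟨U, φ', hU, hφ', hn⟩ := exists_compression φ hε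
    rw [← hn, hφ']
    simp only [kronForm_mulVec]
    exact form_le_of_square hN hM f hK hK' hγ hγ' hω (hC.compress hU) hA φ'
  have hlim : Filter.Tendsto (fun ε : ℝ => V * (normSqVec φ + Q * ε))
      (nhdsWithin 0 (Set.Ioi 0)) (nhds (V * normSqVec φ)) := by
    have : Continuous fun ε : ℝ => V * (normSqVec φ + Q * ε) := by fun_prop
    simpa using (this.tendsto 0).mono_left nhdsWithin_le_nhds
  exact ge_of_tendsto hlim (Filter.eventually_of_mem self_mem_nhdsWithin h)

theorem form_le_of_factorNorm (hN : 0 < N) (hM : 0 < M) (f : Fin D → Fin N → Fin M) (hK : 0 < K)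
    (hK' : 0 < K') (hγ : (γ : ℝ) = N / K) (hγ' : (γ' : ℝ) = M / K')
    (hω : entangledValueDim (neighbor f) γ γ' Q ≠ ⊤) {R : ℕ}
    {c : Matrix (Fin R × Fin M) (Fin R × Fin M) ℂ} {a : Matrix (Fin Q × Fin N) (Fin Q × Fin N) ℂ}
    {s t : ℝ} (hs : 0 < s) (ht : 0 < t) (hc : factorNorm K' c ≤ s) (ha : factorNorm K a ≤ t)
    (φ : Fin R × Fin Q → ℂ) :
    ∑ v, ∑ u, edgeWeight f v u * kronForm φ (rowBlock c v * (rowBlock c v)ᴴ)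
        (rowBlock a u * (rowBlock a u)ᴴ) ≤
      (s * t) ^ 2 * (256 * (entangledValueDim (neighbor f) γ γ' Q).toReal * normSqVec φ) := by
  have h := form_le hN hM f hK hK' hγ hγ' hω (isBoundedFamily_rowBlock hK' hs hc)
    (isBoundedFamily_rowBlock hK ht ha) φ
  have hst : 0 < (s * t) ^ 2 := by positivity
  refine le_of_eq_of_le ?_ (mul_le_mul_of_nonneg_left h hst.le)
  simp only [map_smul, LinearMap.smul_apply, smul_eq_mul, Finset.mul_sum]
  refine Finset.sum_congr rfl fun v _ => Finset.sum_congr rfl fun u _ => ?_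
  field_simp

/-- Cauchy–Schwarz for the vectors `(c ⊗ a)* φ` and `(d ⊗ b)* ψ`. -/
theorem norm_form_le {R : ℕ} {m n : Type} [Fintype m] [Fintype n]
    (c d : Matrix (Fin R) m ℂ) (a b : Matrix (Fin Q) n ℂ) (φ ψ : Fin R × Fin Q → ℂ) :
    ‖star φ ⬝ᵥ (((c * dᴴ) ⊗ₖ (a * bᴴ)) *ᵥ ψ)‖ ≤
      √(kronForm φ (c * cᴴ) (a * aᴴ)) * √(kronForm ψ (d * dᴴ) (b * bᴴ)) := by
  have h : ∀ (c d : Matrix (Fin R) m ℂ) (a b : Matrix (Fin Q) n ℂ) (φ ψ : Fin R × Fin Q → ℂ),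
      star φ ⬝ᵥ (((c * dᴴ) ⊗ₖ (a * bᴴ)) *ᵥ ψ) =
        star ((c ⊗ₖ a)ᴴ *ᵥ φ) ⬝ᵥ ((d ⊗ₖ b)ᴴ *ᵥ ψ) := fun c d a b φ ψ => by
    rw [Matrix.star_mulVec, ← Matrix.dotProduct_mulVec, Matrix.mulVec_mulVec,
      Matrix.conjTranspose_conjTranspose, Matrix.conjTranspose_kronecker,
      ← Matrix.mul_kronecker_mul]
  rw [kronForm_apply, kronForm_apply, h, h, h]
  exact norm_dotProduct_le _ _

/-- Cauchy–Schwarz is used twice, on each term and on the weighted sum over `(v, u)`; nonnegativity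
of the weights is essential. It leaves the positive forms of the left factors and of the right
factors. The infimum over factorizations need not be attained, hence the slack `η → 1`. -/
theorem opNorm_le_of_capCap (hN : 0 < N) (hM : 0 < M) (f : Fin D → Fin N → Fin M) (hK : 0 < K)
    (hK' : 0 < K') (hγ : (γ : ℝ) = N / K) (hγ' : (γ' : ℝ) = M / K')
    (hω : entangledValueDim (neighbor f) γ γ' Q ≠ ⊤) {R : ℕ} {z : MatOver R M} {x : MatOver Q N}
    (hz : capCap M K' R z ≤ 1) (hx : capCap N K Q x ≤ 1) :
    opNorm (∑ v, z v ⊗ₖ amplification (conMap f) x v) ≤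
      256 * (entangledValueDim (neighbor f) γ γ' Q).toReal := by
  set V := 256 * (entangledValueDim (neighbor f) γ γ' Q).toReal with hV
  have hV0 : 0 ≤ V := by positivity
  have key : ∀ η : ℝ, 1 < η →
      opNorm (∑ v, z v ⊗ₖ amplification (conMap f) x v) ≤ η ^ 2 * V := by
    intro η hη
    obtain ⟨c, d, sc, sd, hcd, hsc, hsd, hc, hd, hscd⟩ := exists_factorization hz hη
    obtain ⟨a, b, sa, sb, hab, hsa, hsb, ha, hb, hsab⟩ := exists_factorization hx hη
    have hblock : ∀ {Q N : ℕ} {x : MatOver Q N}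
        {a b : Matrix (Fin Q × Fin N) (Fin Q × Fin N) ℂ}, a * bᴴ = Matrix.blockDiagonal x →
        ∀ u, x u = rowBlock a u * (rowBlock b u)ᴴ := by
      intro Q N x a b h u
      rw [rowBlock_mul_conjTranspose, h]
      ext i j
      simp [Matrix.blockDiagonal_apply]
    refine opNorm_le_of_forall (by positivity) fun φ ψ => ?_
    have h1 := form_le_of_factorNorm hN hM f hK hK' hγ hγ' hω hsc hsa hc ha φ
    have h2 := form_le_of_factorNorm hN hM f hK hK' hγ hγ' hω hsd hsb hd hb ψ
    rw [← hV] at h1 h2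
    set F := fun v u => kronForm φ (rowBlock c v * (rowBlock c v)ᴴ)
      (rowBlock a u * (rowBlock a u)ᴴ) with hF
    set G := fun v u => kronForm ψ (rowBlock d v * (rowBlock d v)ᴴ)
      (rowBlock b u * (rowBlock b u)ᴴ) with hG
    have hF0 : ∀ v u, 0 ≤ F v u := fun v u => kronForm_nonneg _ _ _
      (Matrix.posSemidef_self_mul_conjTranspose _).nonneg
      (Matrix.posSemidef_self_mul_conjTranspose _).nonneg
    have hG0 : ∀ v u, 0 ≤ G v u := fun v u => kronForm_nonneg _ _ _
      (Matrix.posSemidef_self_mul_conjTranspose _).nonneg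
      (Matrix.posSemidef_self_mul_conjTranspose _).nonneg
    have hexpand : star φ ⬝ᵥ ((∑ v, z v ⊗ₖ amplification (conMap f) x v) *ᵥ ψ) =
        ∑ v, ∑ u, edgeWeight f v u • (star φ ⬝ᵥ ((z v ⊗ₖ x u) *ᵥ ψ)) := by
      rw [Matrix.sum_mulVec, dotProduct_sum]
      refine Finset.sum_congr rfl fun v _ => ?_
      have : z v ⊗ₖ amplification (conMap f) x v = ∑ u, edgeWeight f v u • (z v ⊗ₖ x u) := by
        rw [amplification_conMap]
        ext i j
        simp [Matrix.kroneckerMap_apply, Matrix.sum_apply, Finset.mul_sum, mul_left_comm]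
      rw [this, Matrix.sum_mulVec, dotProduct_sum]
      refine Finset.sum_congr rfl fun u _ => ?_
      rw [Matrix.smul_mulVec, dotProduct_smul]
    rw [hexpand]
    calc ‖∑ v, ∑ u, edgeWeight f v u • (star φ ⬝ᵥ ((z v ⊗ₖ x u) *ᵥ ψ))‖
        ≤ ∑ v, ∑ u, edgeWeight f v u * (√(F v u) * √(G v u)) := by
          refine (norm_sum_le _ _).trans (Finset.sum_le_sum fun v _ =>
            (norm_sum_le _ _).trans (Finset.sum_le_sum fun u _ => ?_))
          rw [norm_smul, Real.norm_of_nonneg (edgeWeight_nonneg f v u), hblock hcd v,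
            hblock hab u]
          exact mul_le_mul_of_nonneg_left (norm_form_le _ _ _ _ _ _) (edgeWeight_nonneg f v u)
      _ = ∑ p : Fin M × Fin N, √(edgeWeight f p.1 p.2 * F p.1 p.2) *
            √(edgeWeight f p.1 p.2 * G p.1 p.2) := by
          rw [Fintype.sum_prod_type]
          refine Finset.sum_congr rfl fun v _ => Finset.sum_congr rfl fun u _ => ?_
          have hw := edgeWeight_nonneg f v u
          rw [Real.sqrt_mul hw, Real.sqrt_mul hw]
          nth_rewrite 1 [← Real.mul_self_sqrt hw]
          ring
      _ ≤ √(∑ p : Fin M × Fin N, edgeWeight f p.1 p.2 * F p.1 p.2) *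
            √(∑ p : Fin M × Fin N, edgeWeight f p.1 p.2 * G p.1 p.2) :=
          Real.sum_sqrt_mul_sqrt_le _
            (fun p => mul_nonneg (edgeWeight_nonneg f _ _) (hF0 _ _))
            (fun p => mul_nonneg (edgeWeight_nonneg f _ _) (hG0 _ _))
      _ ≤ √((sc * sa) ^ 2 * (V * normSqVec φ)) * √((sd * sb) ^ 2 * (V * normSqVec ψ)) := by
          rw [Fintype.sum_prod_type, Fintype.sum_prod_type]
          gcongr
      _ = (sc * sd) * (sa * sb) * V * (√(normSqVec φ) * √(normSqVec ψ)) := by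
          rw [Real.sqrt_mul (sq_nonneg (sc * sa)), Real.sqrt_mul (sq_nonneg (sd * sb)),
            Real.sqrt_mul hV0, Real.sqrt_mul hV0, Real.sqrt_sq (by positivity),
            Real.sqrt_sq (by positivity)]
          linear_combination sc * sa * sd * sb * √(normSqVec φ) * √(normSqVec ψ) *
            Real.mul_self_sqrt hV0
      _ ≤ η * η * V * (√(normSqVec φ) * √(normSqVec ψ)) := by gcongr
      _ = η ^ 2 * V * (√(normSqVec φ) * √(normSqVec ψ)) := by ring
  have hlim : Filter.Tendsto (fun η : ℝ => η ^ 2 * V) (nhdsWithin 1 (Set.Ioi 1)) (nhds V) := by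
    have : Continuous fun η : ℝ => η ^ 2 * V := by fun_prop
    simpa using (this.tendsto 1).mono_left nhdsWithin_le_nhds
  exact ge_of_tendsto hlim (Filter.eventually_of_mem self_mem_nhdsWithin key)

theorem le_entangledValueDim (hN : 0 < N) (hM : 0 < M) (f : Fin D → Fin N → Fin M) (hK : 0 < K)
    (hK' : 0 < K') (hγ : (γ : ℝ) = N / K) (hγ' : (γ' : ℝ) = M / K') (Q : ℕ) :
    ENNReal.ofReal K'⁻¹ * amplifiedNorm (capCap N K) (sigmaSigma M K') Q (conMap f) ≤
      256 * entangledValueDim (neighbor f) γ γ' Q := by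
  -- An infinite value makes the bound trivial, so finiteness need not be proved separately.
  by_cases hω : entangledValueDim (neighbor f) γ γ' Q = ⊤
  · rw [hω, ENNReal.mul_top (by norm_num)]
    exact le_top
  · rw [inv_mul_amplifiedNorm hK']
    refine iSup₂_le fun x hx => iSup_le fun R => iSup₂_le fun z hz => ?_
    refine (ENNReal.ofReal_le_ofReal
      (opNorm_le_of_capCap hN hM f hK hK' hγ hγ' hω hz hx)).trans_eq ?_
    rw [ENNReal.ofReal_mul (by norm_num), ENNReal.ofReal_toReal hω]
    norm_num

end Rounding

end Entangled

/-! ### The classical value and the bounded norm -/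

section Classical

/-- A deterministic strategy, as a family of scalar measurements. -/
def detMeas {N γ : ℕ} (a : (Fin γ → Fin N) → Fin γ) (α : Fin γ) (x : Fin γ → Fin N) : ℂ :=
  if a x = α then 1 else 0

/-- The form `(X, Y) ↦ Re X · Re Y`. -/
noncomputable def reForm : ℂ →ₗ[ℝ] ℂ →ₗ[ℝ] ℝ :=
  (LinearMap.mul ℝ ℝ).compl₁₂ Complex.reLm Complex.reLm

theorem reForm_apply (X Y : ℂ) : reForm X Y = X.re * Y.re := rfl

theorem isBoundedFamily_detMeas {N γ : ℕ} (hN : 0 < N) {K : ℝ} (hK : 0 < K)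
    (hγ : (γ : ℝ) = N / K) (a : (Fin γ → Fin N) → Fin γ) :
    IsBoundedFamily K (avgFamily (detMeas a)) := by
  refine isBoundedFamily_avgFamily hN hK hγ (fun α x => ?_) fun x => ?_
  · unfold detMeas
    split_ifs <;> simp
  · simp [detMeas]

theorem classicalGame_eq {N M D γ γ' : ℕ} (f : Fin D → Fin N → Fin M)
    (a : (Fin γ → Fin N) → Fin γ) (b : (Fin γ' → Fin M) → Fin γ') :
    (𝔼 s : Fin D, 𝔼 x : Fin γ → Fin N, 𝔼 y : Fin γ' → Fin M,
      edgeIndicator (neighbor f) (x (a x)) s (y (b y))) =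
    ∑ v, ∑ u, edgeWeight f v u * ((avgFamily (detMeas b) v).re * (avgFamily (detMeas a) u).re) := by
  have h := sum_weight_avgFamily (edgeWeight f) reForm (detMeas a) (detMeas b)
  simp only [reForm_apply] at h
  rw [h, ← expect_game f fun α x β y => (detMeas b β y).re * (detMeas a α x).re]
  simp [detMeas, apply_ite Complex.re]

/-- For each question `x` the payoff is linear in the answer distribution, so answering an `α` that
maximizes `g (x α)` is at least as good. -/
theorem exists_detMeas_le {N γ : ℕ} (hγ : 0 < γ) {P : Fin γ → (Fin γ → Fin N) → ℂ}
    (h0 : ∀ α x, 0 ≤ P α x) (h1 : ∀ x, ∑ α, P α x ≤ 1) {g : Fin N → ℝ} (hg : ∀ u, 0 ≤ g u) :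
    ∃ a : (Fin γ → Fin N) → Fin γ,
      ∑ u, g u * (avgFamily P u).re ≤ ∑ u, g u * (avgFamily (detMeas a) u).re := by
  have : Nonempty (Fin γ) := ⟨⟨0, hγ⟩⟩
  choose a ha using fun x : Fin γ → Fin N => Finite.exists_max fun α => g (x α)
  refine ⟨a, ?_⟩
  have h : ∀ R : Fin γ → (Fin γ → Fin N) → ℂ, ∑ u, g u * (avgFamily R u).re =
      𝔼 x : Fin γ → Fin N, ∑ α, g (x α) * (R α x).re := fun R =>
    sum_apply_avgFamily R fun u => g u • Complex.reLm
  rw [h, h]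
  refine Finset.expect_le_expect fun x _ => ?_
  have h2 : ∑ α, (P α x).re ≤ 1 := by
    have := (Complex.le_def.1 (h1 x)).1
    rwa [Complex.re_sum, Complex.one_re] at this
  calc ∑ α, g (x α) * (P α x).re ≤ ∑ α, g (x (a x)) * (P α x).re :=
        Finset.sum_le_sum fun α _ =>
          mul_le_mul_of_nonneg_right (ha x α) (Complex.le_def.1 (h0 α x)).1
    _ = g (x (a x)) * ∑ α, (P α x).re := by rw [Finset.mul_sum]
    _ ≤ g (x (a x)) * 1 := mul_le_mul_of_nonneg_left h2 (hg _)
    _ = _ := by simp [detMeas, apply_ite Complex.re]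

theorem IsBoundedFamily.norm_eq {ι : Type*} [Fintype ι] {K : ℝ} {a : ι → ℂ}
    (ha : IsBoundedFamily K a) (u : ι) : ‖a u‖ = (a u).re := by
  simpa using congrArg Complex.re (Complex.norm_of_nonneg' (ha.nonneg u))

theorem isBoundedFamily_ofReal {ι : Type*} [Fintype ι] {K : ℝ} {a : ι → ℝ} (h0 : ∀ u, 0 ≤ a u)
    (hK : ∀ u, K * a u ≤ 1) (h1 : ∑ u, a u ≤ 1) : IsBoundedFamily K fun u => (a u : ℂ) := by
  refine ⟨fun u => by exact_mod_cast h0 u, fun u => ?_, by exact_mod_cast h1⟩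
  rw [Complex.real_smul]
  exact_mod_cast hK u

theorem IsBoundedFamily.smul_norm_le {ι : Type*} [Fintype ι] {K : ℝ} {a : ι → ℂ}
    (ha : IsBoundedFamily K a) (u : ι) : K * ‖a u‖ ≤ 1 := by
  have := (Complex.le_def.1 (ha.smul_le_one u)).1
  rwa [Complex.smul_re, Complex.one_re, smul_eq_mul, ← ha.norm_eq] at this

theorem IsBoundedFamily.sum_norm_le {ι : Type*} [Fintype ι] {K : ℝ} {a : ι → ℂ}
    (ha : IsBoundedFamily K a) : ∑ u, ‖a u‖ ≤ 1 := by
  have := (Complex.le_def.1 ha.sum_le_one).1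
  rw [Complex.re_sum, Complex.one_re] at this
  simpa only [ha.norm_eq] using this

theorem capNorm_le_one {N : ℕ} {K : ℝ} (hK : 0 < K) {a : Fin N → ℂ} (ha : IsBoundedFamily K a) :
    capNorm K a ≤ 1 := by
  refine max_le ?_ ha.sum_norm_le
  rw [← le_div_iff₀' hK]
  exact (pi_norm_le_iff_of_nonneg (by positivity)).2 fun u =>
    (le_div_iff₀' hK).2 (ha.smul_norm_le u)

theorem re_sum_mul_le_sigmaNorm {M : ℕ} {K' : ℝ} {z : Fin M → ℂ}
    (hz : IsBoundedFamily K' z) (hK' : 0 < K') (y : Fin M → ℂ) :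
    ENNReal.ofReal (K' * ∑ v, (z v).re * (y v).re) ≤ sigmaNorm K' y := by
  refine le_iInf fun y₁ => le_iInf fun y₂ => le_iInf fun hy => ENNReal.ofReal_le_ofReal ?_
  have h1 : ∀ v, K' * ((z v).re * (y v).re) ≤ K' * (‖z v‖ * ‖y₁‖) + ‖y₂ v‖ := by
    intro v
    have hv : (y v).re ≤ ‖y₁‖ + ‖y₂ v‖ := by
      rw [← hy]
      refine (Complex.re_le_norm _).trans ((norm_add_le _ _).trans ?_)
      gcongr
      exact norm_le_pi_norm y₁ v
    calc K' * ((z v).re * (y v).re) ≤ K' * (‖z v‖ * (‖y₁‖ + ‖y₂ v‖)) := by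
          rw [← hz.norm_eq]
          gcongr
      _ = K' * (‖z v‖ * ‖y₁‖) + (K' * ‖z v‖) * ‖y₂ v‖ := by ring
      _ ≤ K' * (‖z v‖ * ‖y₁‖) + 1 * ‖y₂ v‖ := by
          gcongr
          exact hz.smul_norm_le v
      _ = _ := by rw [one_mul]
  calc K' * ∑ v, (z v).re * (y v).re ≤ ∑ v, (K' * (‖z v‖ * ‖y₁‖) + ‖y₂ v‖) := by
        rw [Finset.mul_sum]
        exact Finset.sum_le_sum fun v _ => h1 v
    _ = K' * ((∑ v, ‖z v‖) * ‖y₁‖) + ∑ v, ‖y₂ v‖ := by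
        rw [Finset.sum_add_distrib, ← Finset.mul_sum, Finset.sum_mul]
    _ ≤ K' * (1 * ‖y₁‖) + ∑ v, ‖y₂ v‖ := by
        gcongr
        exact hz.sum_norm_le
    _ = _ := by rw [one_mul]

theorem classicalValue_le {N M D γ γ' : ℕ} (hN : 0 < N) (hM : 0 < M)
    (f : Fin D → Fin N → Fin M) {K K' : ℝ} (hK : 0 < K) (hK' : 0 < K') (hγ : (γ : ℝ) = N / K)
    (hγ' : (γ' : ℝ) = M / K') :
    classicalValue (neighbor f) γ γ' ≤ ENNReal.ofReal K'⁻¹ * boundedNorm K K' (conMap f) := by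
  refine iSup₂_le fun a b => ?_
  have hx := isBoundedFamily_detMeas hN hK hγ a
  have hz := isBoundedFamily_detMeas hM hK' hγ' b
  have h1 := re_sum_mul_le_sigmaNorm hz hK' (conMap f (avgFamily (detMeas a)))
  have h2 : sigmaNorm K' (conMap f (avgFamily (detMeas a))) ≤ boundedNorm K K' (conMap f) :=
    le_iSup₂_of_le _ (capNorm_le_one hK hx) le_rfl
  refine le_trans (le_of_eq ?_) (mul_le_mul_right (h1.trans h2) _)
  rw [← ENNReal.ofReal_mul (by positivity), inv_mul_cancel_left₀ hK'.ne', classicalGame_eq]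
  congr 1
  refine Finset.sum_congr rfl fun v _ => ?_
  rw [conMap_apply, Complex.re_sum, Finset.mul_sum]
  refine Finset.sum_congr rfl fun u _ => ?_
  rw [Complex.re_ofReal_mul]
  ring

/-- The norm `Σ{K ℓ∞, ℓ1}` is attained, up to a constant, on a bounded family. -/
theorem exists_sigmaNorm_le {M : ℕ} (hM : 0 < M) {K' : ℝ} (hK' : 0 < K') (hKM : K' ≤ M)
    (y : Fin M → ℂ) : ∃ z : Fin M → ℝ, (∀ v, 0 ≤ z v) ∧ (∀ v, K' * z v ≤ 1) ∧ ∑ v, z v ≤ 1 ∧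
      sigmaNorm K' y ≤ ENNReal.ofReal (3 * (K' * ∑ v, z v * ‖y v‖)) := by
  -- For `K' < 1` the floor of `K'` would be 0; there a point mass at a largest coordinate suffices.
  rcases lt_or_ge K' 1 with h | h
  · have : Nonempty (Fin M) := ⟨⟨0, hM⟩⟩
    obtain ⟨v₀, hv₀⟩ := Finite.exists_max fun v => ‖y v‖
    refine ⟨fun v => if v = v₀ then 1 else 0, fun v => ?_, fun v => ?_, by simp, ?_⟩
    · dsimp only
      split_ifs <;> norm_num
    · dsimp only
      split_ifs
      · linarith
      · simp
    · refine iInf₂_le_of_le y 0 (iInf_le_of_le (add_zero y) (ENNReal.ofReal_le_ofReal ?_))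
      have hy : ‖y‖ ≤ ‖y v₀‖ := (pi_norm_le_iff_of_nonneg (norm_nonneg _)).2 hv₀
      have h1 : K' * ‖y‖ ≤ K' * ‖y v₀‖ := by gcongr
      have h2 : 0 ≤ K' * ‖y v₀‖ := by positivity
      simp only [Pi.zero_apply, norm_zero, Finset.sum_const_zero, add_zero, ite_mul, one_mul,
        zero_mul, Finset.sum_ite_eq', Finset.mem_univ, if_true]
      linarith
  · set n := ⌊K'⌋₊ with hn
    have hn1 : 1 ≤ n := Nat.le_floor (by simpa using h)
    have hnK : (n : ℝ) ≤ K' := Nat.floor_le hK'.le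
    have hKn : K' ≤ 2 * n := by
      have h1 := Nat.lt_floor_add_one K'
      have h2 : (1 : ℝ) ≤ n := by exact_mod_cast hn1
      linarith
    have hnM : n ≤ (Finset.univ : Finset (Fin M)).card := by
      rw [Finset.card_univ, Fintype.card_fin]
      exact_mod_cast hnK.trans hKM
    -- `S` holds `n = ⌊K'⌋` largest coordinates, with sum `T`. The part on `S` costs `T` in `ℓ1`;
    -- off `S` every coordinate is at most the mean `T/n`, costing `K' T/n ≤ 2T`. Total `3T`.
    obtain ⟨S, hS, hmax⟩ := Finset.exists_max_image (Finset.powersetCard n Finset.univ)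
      (fun S : Finset (Fin M) => ∑ v ∈ S, ‖y v‖) (Finset.powersetCard_nonempty.2 hnM)
    have hcard : S.card = n := (Finset.mem_powersetCard.1 hS).2
    have hex : ∀ v, v ∉ S → ∀ i ∈ S, ‖y v‖ ≤ ‖y i‖ := by
      intro v hv i hi
      have hv' : v ∉ S.erase i := fun h => hv (Finset.mem_of_mem_erase h)
      have h1 := hmax (insert v (S.erase i)) (Finset.mem_powersetCard.2 ⟨Finset.subset_univ _, by
        rw [Finset.card_insert_of_notMem hv', Finset.card_erase_of_mem hi, hcard]; omega⟩)
      rw [Finset.sum_insert hv', ← Finset.add_sum_erase S (fun v => ‖y v‖) hi] at h1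
      linarith
    set T := ∑ v ∈ S, ‖y v‖ with hT
    have hT0 : 0 ≤ T := Finset.sum_nonneg fun v _ => norm_nonneg _
    refine ⟨fun v => if v ∈ S then K'⁻¹ else 0, fun v => ?_, fun v => ?_, ?_, ?_⟩
    · dsimp only
      split_ifs <;> positivity
    · dsimp only
      split_ifs
      · rw [mul_inv_cancel₀ hK'.ne']
      · simp
    · rw [Finset.sum_ite_mem, Finset.univ_inter, Finset.sum_const, hcard, nsmul_eq_mul,
        ← div_eq_mul_inv]
      exact (div_le_one hK').2 hnK
    · refine iInf₂_le_of_le (fun v => if v ∈ S then 0 else y v) (fun v => if v ∈ S then y v else 0)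
        (iInf_le_of_le ?_ (ENNReal.ofReal_le_ofReal ?_))
      · ext v
        by_cases hv : v ∈ S <;> simp [hv]
      · have h1 : K' * ∑ v, (if v ∈ S then K'⁻¹ else 0) * ‖y v‖ = T := by
          simp only [ite_mul, zero_mul]
          rw [Finset.sum_ite_mem, Finset.univ_inter, ← Finset.mul_sum,
            mul_inv_cancel_left₀ hK'.ne']
        have h2 : ∑ v, ‖(if v ∈ S then y v else 0)‖ = T := by
          simp only [apply_ite norm, norm_zero]
          rw [Finset.sum_ite_mem, Finset.univ_inter]
        have hn0 : (0 : ℝ) < n := by exact_mod_cast hn1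
        have h3 : ‖fun v => if v ∈ S then 0 else y v‖ ≤ T / n := by
          refine (pi_norm_le_iff_of_nonneg (by positivity)).2 fun v => ?_
          by_cases hv : v ∈ S
          · simp only [hv, if_true, norm_zero]
            positivity
          · simp only [hv, if_false]
            rw [le_div_iff₀' hn0]
            have := Finset.card_nsmul_le_sum S (fun i => ‖y i‖) ‖y v‖ (hex v hv)
            rwa [hcard, nsmul_eq_mul] at this
        rw [h1, h2]
        have h4 : K' * ‖fun v => if v ∈ S then 0 else y v‖ ≤ 2 * n * (T / n) :=
          mul_le_mul hKn h3 (norm_nonneg _) (by positivity)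
        have h5 : 2 * (n : ℝ) * (T / n) = 2 * T := by field_simp
        linarith

theorem le_classicalValue {N M D γ γ' : ℕ} (hN : 0 < N) (hM : 0 < M)
    (f : Fin D → Fin N → Fin M) {K K' : ℝ} (hK : 0 < K) (hK' : 0 < K') (hγ : (γ : ℝ) = N / K)
    (hγ' : (γ' : ℝ) = M / K') :
    ENNReal.ofReal K'⁻¹ * boundedNorm K K' (conMap f) ≤
      768 * classicalValue (neighbor f) γ γ' := by
  have hN' : (0 : ℝ) < N := by exact_mod_cast hN
  have hM' : (0 : ℝ) < M := by exact_mod_cast hM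
  have hγ0 : 0 < γ := by
    have : (0 : ℝ) < γ := by rw [hγ]; positivity
    exact_mod_cast this
  have hγ'0 : 0 < γ' := by
    have : (0 : ℝ) < γ' := by rw [hγ']; positivity
    exact_mod_cast this
  have hKM : K' ≤ M := by
    have h1 : (1 : ℝ) ≤ γ' := by exact_mod_cast hγ'0
    rw [hγ', le_div_iff₀ hK', one_mul] at h1
    exact h1
  simp only [boundedNorm, ENNReal.mul_iSup]
  refine iSup₂_le fun x hx => ?_
  obtain ⟨z, hz0, hzK, hz1, hz⟩ := exists_sigmaNorm_le hM hK' hKM (conMap f x)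
  have hA : IsBoundedFamily K fun u => ((‖x u‖ : ℝ) : ℂ) := by
    refine isBoundedFamily_ofReal (fun u => norm_nonneg _) (fun u => ?_)
      ((le_max_right _ _).trans hx)
    exact (mul_le_mul_of_nonneg_left (norm_le_pi_norm x u) hK.le).trans ((le_max_left _ _).trans hx)
  obtain ⟨P, P', hP0, hP1, hP'0, hP'1, h⟩ := exists_meas_pair hN hM hK hK' hγ hγ'
    (edgeWeight_nonneg f) reForm
    (fun c a hc ha => mul_nonneg (Complex.le_def.1 hc).1 (Complex.le_def.1 ha).1)
    (isBoundedFamily_ofReal hz0 hzK hz1) hA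
  simp only [reForm_apply, Complex.ofReal_re] at h
  have hP'b := isBoundedFamily_avgFamily hM hK' hγ' hP'0 hP'1
  obtain ⟨a, ha⟩ := exists_detMeas_le hγ0 hP0 hP1
    (g := fun u => ∑ v, edgeWeight f v u * (avgFamily P' v).re) fun u =>
      Finset.sum_nonneg fun v _ => mul_nonneg (edgeWeight_nonneg f v u)
        (Complex.le_def.1 (hP'b.nonneg v)).1
  have hab := isBoundedFamily_detMeas hN hK hγ a
  -- The players are derandomized in turn: Bob's weights come from Alice's strategy once it is
  -- deterministic.
  obtain ⟨b, hb⟩ := exists_detMeas_le hγ'0 hP'0 hP'1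
    (g := fun v => ∑ u, edgeWeight f v u * (avgFamily (detMeas a) u).re) fun v =>
      Finset.sum_nonneg fun u _ => mul_nonneg (edgeWeight_nonneg f v u)
        (Complex.le_def.1 (hab.nonneg u)).1
  have e : ∀ (p : Fin N → ℝ) (q : Fin M → ℝ),
      ∑ u, (∑ v, edgeWeight f v u * q v) * p u = ∑ v, ∑ u, edgeWeight f v u * (q v * p u) := by
    intro p q
    simp only [Finset.sum_mul, mul_assoc]
    rw [Finset.sum_comm]
  have e' : ∀ (p : Fin N → ℝ) (q : Fin M → ℝ),
      ∑ v, (∑ u, edgeWeight f v u * p u) * q v = ∑ v, ∑ u, edgeWeight f v u * (q v * p u) := by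
    intro p q
    simp only [Finset.sum_mul, mul_assoc, mul_comm (q _)]
  rw [e fun u => (avgFamily P u).re, e fun u => (avgFamily (detMeas a) u).re] at ha
  rw [e' (fun u => (avgFamily (detMeas a) u).re) fun v => (avgFamily P' v).re,
    e' (fun u => (avgFamily (detMeas a) u).re) fun v => (avgFamily (detMeas b) v).re,
    ← classicalGame_eq] at hb
  set val := 𝔼 s : Fin D, 𝔼 x : Fin γ → Fin N, 𝔼 y : Fin γ' → Fin M,
      edgeIndicator (neighbor f) (x (a x)) s (y (b y)) with hval
  have hzy : ∑ v, z v * ‖conMap f x v‖ ≤ 256 * val := by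
    refine le_trans (Finset.sum_le_sum fun v _ => ?_) (h.trans (by linarith))
    have : ‖conMap f x v‖ ≤ ∑ u, edgeWeight f v u * ‖x u‖ := by
      rw [conMap_apply]
      refine (norm_sum_le _ _).trans (Finset.sum_le_sum fun u _ => ?_)
      rw [norm_mul, Complex.norm_of_nonneg (edgeWeight_nonneg f v u)]
    refine (mul_le_mul_of_nonneg_left this (hz0 v)).trans (le_of_eq ?_)
    rw [Finset.mul_sum]
    exact Finset.sum_congr rfl fun u _ => by ring
  calc ENNReal.ofReal K'⁻¹ * sigmaNorm K' (conMap f x)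
      ≤ ENNReal.ofReal K'⁻¹ * ENNReal.ofReal (3 * (K' * ∑ v, z v * ‖conMap f x v‖)) := by gcongr
    _ = ENNReal.ofReal (3 * ∑ v, z v * ‖conMap f x v‖) := by
        rw [← ENNReal.ofReal_mul (by positivity)]
        congr 1
        field_simp
    _ ≤ ENNReal.ofReal (768 * val) := ENNReal.ofReal_le_ofReal (by linarith)
    _ = 768 * ENNReal.ofReal val := by
        rw [ENNReal.ofReal_mul (by norm_num)]
        norm_num
    _ ≤ 768 * classicalValue (neighbor f) γ γ' := by
        gcongr
        exact le_iSup₂_of_le a b le_rfl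

end Classical

end Condenser

open Condenser in
theorem theorem8 :
    ∃ c : ℝ≥0, 0 < c ∧
      ∀ (N M D : ℕ) (_ : 0 < N) (_ : 0 < M) (_ : 0 < D) (f : Fin D → Fin N → Fin M)
        (k k' : ℝ) (γ γ' : ℕ)
        (_ : (γ : ℝ) = (N : ℝ) / (2 : ℝ) ^ k) (_ : (γ' : ℝ) = (M : ℝ) / (2 : ℝ) ^ k'),
        (classicalValue (neighbor f) γ γ' ≤
            ENNReal.ofReal ((2 : ℝ) ^ (-k')) *
              boundedNorm ((2 : ℝ) ^ k) ((2 : ℝ) ^ k') (conMap f) ∧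
          ENNReal.ofReal ((2 : ℝ) ^ (-k')) *
              boundedNorm ((2 : ℝ) ^ k) ((2 : ℝ) ^ k') (conMap f) ≤
            (c : ℝ≥0∞) * classicalValue (neighbor f) γ γ') ∧
        (entangledValue (neighbor f) γ γ' ≤
            ENNReal.ofReal ((2 : ℝ) ^ (-k')) *
              cbNorm (capCap N ((2 : ℝ) ^ k)) (sigmaSigma M ((2 : ℝ) ^ k')) (conMap f) ∧
          ENNReal.ofReal ((2 : ℝ) ^ (-k')) *
              cbNorm (capCap N ((2 : ℝ) ^ k)) (sigmaSigma M ((2 : ℝ) ^ k')) (conMap f) ≤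
            (c : ℝ≥0∞) * entangledValue (neighbor f) γ γ') ∧
        ∀ Q : ℕ, 0 < Q →
          entangledValueDim (neighbor f) γ γ' Q ≤
              ENNReal.ofReal ((2 : ℝ) ^ (-k')) *
                amplifiedNorm (capCap N ((2 : ℝ) ^ k)) (sigmaSigma M ((2 : ℝ) ^ k')) Q
                  (conMap f) ∧
            ENNReal.ofReal ((2 : ℝ) ^ (-k')) *
                amplifiedNorm (capCap N ((2 : ℝ) ^ k)) (sigmaSigma M ((2 : ℝ) ^ k')) Q
                  (conMap f) ≤
              (c : ℝ≥0∞) * entangledValueDim (neighbor f) γ γ' Q := by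
  -- The classical bound needs `3 · 256`; the entangled bounds hold with 256.
  refine ⟨768, by norm_num, ?_⟩
  intro N M D hN hM _ f k k' γ γ' hγ hγ'
  have hK : (0 : ℝ) < 2 ^ k := by positivity
  have hK' : (0 : ℝ) < 2 ^ k' := by positivity
  rw [Real.rpow_neg zero_le_two]
  have hle := entangledValueDim_le hN hM f hK hK' hγ hγ'
  have hge : ∀ Q, ENNReal.ofReal ((2 : ℝ) ^ k')⁻¹ *
      amplifiedNorm (capCap N ((2 : ℝ) ^ k)) (sigmaSigma M ((2 : ℝ) ^ k')) Q (conMap f) ≤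
        ((768 : ℝ≥0) : ℝ≥0∞) * entangledValueDim (neighbor f) γ γ' Q := fun Q =>
    (le_entangledValueDim hN hM f hK hK' hγ hγ' Q).trans
      (mul_le_mul_left (by norm_num) _)
  refine ⟨⟨classicalValue_le hN hM f hK hK' hγ hγ', ?_⟩, ⟨?_, ?_⟩, fun Q _ => ⟨hle Q, hge Q⟩⟩
  · simpa using le_classicalValue hN hM f hK hK' hγ hγ'
  -- The bounds hold for each `Q` with the same constant, so they pass to the suprema.
  · rw [cbNorm, ENNReal.mul_iSup]
    exact iSup_mono hle
  · rw [cbNorm, entangledValue, ENNReal.mul_iSup, ENNReal.mul_iSup]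
    exact iSup_mono hge
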